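/- **Setting.** There are $M$ categories of $K$ arms each. Arm $k$ of category $m$ has a reward distribution $\nu^m_k$ on $\mathbb{R}$ with mean $\mu^m_k$ that is $1$-sub-Gaussian: $\int e^{\lambda(x-\mu^m_k)}\,d\nu^m_k(x)\le e^{\lambda^2/2}$ for all $\lambda\in\mathbb{R}$. The successive rewards of an arm are i.i.d., and rewards of different arms are independent. Group-sparse dominance: one category, numbered $1$, contains an arm with positive mean, and all arms of all other categories have mean $\le 0$. Number the arms of category $1$ so that $\mu^1_1=\max_k\mu^1_k$ (hence $\mu_1^1>0$ is the largest mean). Let $\Delta_{m,k}=\mu^1_1-\mu^m_k$. If $(C_t,A_t)$ is the category and arm pulled at round $t$, the regret is $R_T=\sum_{t=1}^T\Delta_{C_t,A_t}$. **Algorithm HSparseUCB.** Let $N^m_k(t)$ be the number of pulls of arm $k$ of category $m$ before round $t$, and $\widehat\mu^m_k(t)$ the average of the rewards they gave. The arm is active at round $t$ if $\widehat\mu^m_k(t)\ge 2\sqrt{\log(N^m_k(t))/N^m_k(t)}$, and a category is active if at least one of its arms is. First each arm is pulled once. Then, repeatedly, at the current round $t$: * if no category is active, all arms are pulled once, one after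 the other (this takes $MK$ rounds); * if exactly one category $C$ is active, an arm of $C$ that maximizes $\widehat\mu^C_k(t)+2\sqrt{\log(t)/N^C_k(t)}$ over $k$ is pulled; * if more than one category is active, an arm is drawn uniformly at random from the set of all active arms, independently of everything else, and is pulled. The order in which "all arms" are pulled is an arbitrary fixed one, and ties in the maximization are broken by an arbitrary rule that depends on the numbers of pulls and the set of maximizers. **Theorem.** For every $T\in\mathbb{N}$ the regret $R_T$ of HSparseUCB is integrable and $$ \mathbb{E}[R_T]\le\sum_{k:\,\Delta_{1,k}>0}\frac{16\log T}{\Delta_{1,k}}+3\sum_{k=1}^K\Delta_{1,k}+\Big(3+\frac{32}{(\mu^1_1)^2}\log\frac{16}{(\mu^1_1)^2}+\frac{8}{(\mu^1_1)^2}\Big)\sum_{m=1}^M\sum_{k=1}^K\Delta_{m,k}+(M-1)K\,\frac{\pi^2}{6}\sum_{m=1}^M\sum_{k=1}^K\Delta_{m,k} $$ (where $\log 0$ is read as $0$ if $T=0$). -/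

import Mathlib

open MeasureTheory ProbabilityTheory

open scoped Classical

noncomputable section

namespace CategorizedBandit

/-- The arms: `(m, k)` is the `k`-th arm of category `m`. -/
abbrev Arm (M K : ℕ) : Type := Fin M × Fin K

variable {M K : ℕ}

/-- The mean of the reward distribution of an arm. -/
def armMean (ν : Arm M K → Measure ℝ) (a : Arm M K) : ℝ := ∫ x, x ∂(ν a)

/-- The gap of the arm `a` to the arm `b`. -/
def gap (ν : Arm M K → Measure ℝ) (b a : Arm M K) : ℝ := armMean ν b - armMean ν a

/-- Group-sparse dominance: the category `m₁` contains an arm with positive mean, and every arm of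
every other category has non-positive mean. -/
def GroupSparse (ν : Arm M K → Measure ℝ) (m₁ : Fin M) : Prop :=
  (∃ k, 0 < armMean ν (m₁, k)) ∧ ∀ m, m ≠ m₁ → ∀ k, armMean ν (m, k) ≤ 0

/-- What the algorithm remembers between two rounds. -/
structure State (M K : ℕ) where
  /-- number of pulls of each arm so far -/
  pulls : Arm M K → ℕ
  /-- sum of the rewards collected so far from each arm -/
  total : Arm M K → ℝ
  /-- arms that are still to be pulled in the current sweep ("pull all arms") -/
  pending : List (Arm M K)

/-- The empirical mean of an arm. -/
def State.empMean (s : State M K) (a : Arm M K) : ℝ := s.total a / (s.pulls a : ℝ)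

/-- The activity test of an arm. -/
def State.IsActive (s : State M K) (a : Arm M K) : Prop :=
  2 * √(Real.log (s.pulls a : ℝ) / (s.pulls a : ℝ)) ≤ s.empMean a

/-- The set of active arms. -/
def State.activeArms (s : State M K) : Finset (Arm M K) :=
  Finset.univ.filter fun a => s.IsActive a

/-- The set of active categories: those with at least one active arm. -/
def State.activeCategories (s : State M K) : Finset (Fin M) :=
  Finset.univ.filter fun m => ∃ k, s.IsActive (m, k)

/-- The UCB index of an arm at round `t`. -/
def State.ucbIndex (s : State M K) (t : ℕ) (a : Arm M K) : ℝ :=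
  s.empMean a + 2 * √(Real.log (t : ℝ) / (s.pulls a : ℝ))

/-- The arms of category `m` with maximal UCB index at round `t`. -/
def State.ucbArgmax (s : State M K) (t : ℕ) (m : Fin M) : Finset (Fin K) :=
  Finset.univ.filter fun k => ∀ j, s.ucbIndex t (m, j) ≤ s.ucbIndex t (m, k)

/-- The arm pulled at round `t` from state `s`, and the rest of the current sweep.

* A sweep that has been started is finished first.
* Otherwise, if no category is active, a new sweep through all arms (in the given order) starts.
* Otherwise, if exactly one category is active, an arm of that category with maximal UCB index is
  pulled; `tie` breaks ties, with access to the numbers of pulls.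
* Otherwise the arm `v S` is pulled, where `S` is the set of active arms. -/
def decision (order : List (Arm M K)) (tie : (Arm M K → ℕ) → Finset (Fin K) → Fin K)
    (v : Finset (Arm M K) → Arm M K) (t : ℕ) (s : State M K) : Arm M K × List (Arm M K) :=
  let todo := if s.pending = [] ∧ s.activeCategories = ∅ then order else s.pending
  match todo with
  | a :: rest => (a, rest)
  | [] =>
    if h : ∃ m, s.activeCategories = {m} then
      ((h.choose, tie s.pulls (s.ucbArgmax t h.choose)), [])
    else (v s.activeArms, [])

/-- HSparseUCB: the state after `t` rounds, when the `(n + 1)`-st pull of the arm `a` yields the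
reward `y a n` and the random draw of round `t` from a set `S` of arms yields `v t S`. The first
sweep pulls each arm once. -/
def run (order : List (Arm M K)) (tie : (Arm M K → ℕ) → Finset (Fin K) → Fin K)
    (y : Arm M K → ℕ → ℝ) (v : ℕ → Finset (Arm M K) → Arm M K) : ℕ → State M K
  | 0 => ⟨fun _ => 0, fun _ => 0, order⟩
  | t + 1 =>
    let s := run order tie y v t
    let d := decision order tie (v (t + 1)) (t + 1) s
    { pulls := fun b => if b = d.1 then s.pulls b + 1 else s.pulls b
      total := fun b => if b = d.1 then s.total b + y b (s.pulls b) else s.total b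
      pending := d.2 }

/-- The arm that HSparseUCB pulls at round `t + 1`. -/
def pulledArm (order : List (Arm M K)) (tie : (Arm M K → ℕ) → Finset (Fin K) → Fin K)
    (y : Arm M K → ℕ → ℝ) (v : ℕ → Finset (Arm M K) → Arm M K) (t : ℕ) : Arm M K :=
  (decision order tie (v (t + 1)) (t + 1) (run order tie y v t)).1

/-- The regret of HSparseUCB after `T` rounds, with respect to the arm `b`. -/
def regret (ν : Arm M K → Measure ℝ) (b : Arm M K) (order : List (Arm M K))
    (tie : (Arm M K → ℕ) → Finset (Fin K) → Fin K)
    (y : Arm M K → ℕ → ℝ) (v : ℕ → Finset (Arm M K) → Arm M K) (T : ℕ) : ℝ :=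
  ∑ t ∈ Finset.range T, gap ν b (pulledArm order tie y v t)

/-- The randomness of the interaction. The successive rewards `Y a 0, Y a 1, …` of the arm `a` have
law `ν a`; for every round `t` and nonempty set `S` of arms, `V t S` is uniform on `S`; all rewards
and the draws of all rounds are independent. -/
structure IsRandomness {Ω : Type*} [MeasurableSpace Ω] (P : Measure Ω) (ν : Arm M K → Measure ℝ)
    (Y : Arm M K → ℕ → Ω → ℝ) (V : ℕ → Finset (Arm M K) → Ω → Arm M K) : Prop where
  measurable_reward : ∀ a n, Measurable (Y a n)
  measurable_draw : ∀ t S, Measurable (V t S)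
  law_reward : ∀ a n, P.map (Y a n) = ν a
  law_draw : ∀ t (S : Finset (Arm M K)), S.Nonempty →
    P.map (V t S) = uniformOn (S : Set (Arm M K))
  indep_rewards : iIndepFun (fun (p : Arm M K × ℕ) ω => Y p.1 p.2 ω) P
  indep_draws : iIndepFun (fun (t : ℕ) ω (S : Finset (Arm M K)) => V t S ω) P
  indep_rewards_draws :
    IndepFun (fun ω (p : Arm M K × ℕ) => Y p.1 p.2 ω)
      (fun ω (p : ℕ × Finset (Arm M K)) => V p.1 p.2 ω) P

end CategorizedBandit

end

/-! Rewards are indexed by pull number, so whether an arm passes the activity test after `n` pulls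
depends on its own reward sequence alone. Each kind of round is charged to pull numbers at which
such an event occurs. Every charged round raises the pull count of some arm, so no pull number is
charged twice, and sub-Gaussian tails bound the expected number of charged pull numbers.

A pull belongs to a sweep, to a uniform draw, or to an index maximization (`claimed_eq`). A later
sweep needs the best arm to be inactive; with mean `μ > 0` this becomes exponentially unlikely once
`log n / n ≤ μ ^ 2 / 16` (`sweeps_le`, `integral_countIn_not_activeAt_le`). A uniform draw needs an
active arm outside the good category, and by symmetry that arm is as likely to be drawn as any other
active one. So draws of any given arm are at most, in expectation, all draws of bad-category arms;
such an arm is active after `n` pulls with probability at most `1 / n ^ 2`, which gives `π ^ 2 / 6`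
per bad arm (`measureReal_multi_pulledArm_le`, `integral_multiPulls_le`). In the good category the
maximization is ordinary UCB, costing `16 log T / Δ ^ 2 + 4` pulls per suboptimal arm
(`ucbPulls_le`, `measureReal_beats_le`).

If a bad category is the only active one, the maximization may select one of its inactive arms. The
threshold and the bonus both favour rarely pulled arms, so a selected inactive arm has fewer pulls
than every active arm of its category. Hence the most pulled arm cannot grow by inactive pulls, and
activity counts bound the whole category (`claimed_le_of_category`). -/

noncomputable section

namespace CategorizedBandit

variable {M K : ℕ}

/-! ### Events indexed by pull numbers, and the types of rounds. -/

/-- The average of the first `n` rewards of the arm `a`. -/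
def rewardMean (y : Arm M K → ℕ → ℝ) (a : Arm M K) (n : ℕ) : ℝ :=
  (∑ i ∈ Finset.range n, y a i) / n

/-- The arm `a` passes the activity test after `n` pulls. -/
def ActiveAt (y : Arm M K → ℕ → ℝ) (a : Arm M K) (n : ℕ) : Prop :=
  2 * √(Real.log n / n) ≤ rewardMean y a n

/-- The number of `n` in `[lo, hi)` with `p n`. -/
def countIn (p : ℕ → Prop) (lo hi : ℕ) : ℕ := ((Finset.Ico lo hi).filter p).card

lemma countIn_mono (p : ℕ → Prop) (lo : ℕ) {hi hi' : ℕ} (h : hi ≤ hi') :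
    countIn p lo hi ≤ countIn p lo hi' :=
  Finset.card_le_card (Finset.filter_subset_filter _ (Finset.Ico_subset_Ico_right h))

lemma countIn_succ {p : ℕ → Prop} {lo hi : ℕ} (h : lo ≤ hi) (hp : p hi) :
    countIn p lo (hi + 1) = countIn p lo hi + 1 := by
  unfold countIn
  rw [← Finset.insert_Ico_right_eq_Ico_add_one h, Finset.filter_insert, if_pos hp,
    Finset.card_insert_of_notMem (by simp)]

/-- A new sweep is about to start. -/
def State.Idle (s : State M K) : Prop := s.pending = [] ∧ s.activeCategories = ∅

/-- The category `m` is the only active one and no sweep is running. -/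
def State.Single (s : State M K) (m : Fin M) : Prop :=
  s.pending = [] ∧ s.activeCategories = {m}

/-- Several categories are active and no sweep is running. -/
def State.Multi (s : State M K) : Prop :=
  s.pending = [] ∧ s.activeCategories ≠ ∅ ∧ ¬∃ m, s.activeCategories = {m}

lemma State.Single.not_idle {s : State M K} {m : Fin M} (h : s.Single m) : ¬s.Idle := by
  rintro ⟨-, h'⟩
  rw [h.2] at h'
  exact Finset.singleton_ne_empty _ h'

lemma State.Multi.not_idle {s : State M K} (h : s.Multi) : ¬s.Idle := fun h' => h.2.1 h'.2

lemma State.Multi.not_single {s : State M K} (h : s.Multi) : ¬∃ m, s.Single m :=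
  fun ⟨m, hm⟩ => h.2.2 ⟨m, hm.2⟩

/-! ### Pathwise bounds on the numbers of pulls. -/

section Path

variable (order : List (Arm M K)) (tie : (Arm M K → ℕ) → Finset (Fin K) → Fin K)
  (y : Arm M K → ℕ → ℝ) (v : ℕ → Finset (Arm M K) → Arm M K)

lemma run_succ_pulls (t : ℕ) (b : Arm M K) :
    (run order tie y v (t + 1)).pulls b =
      (run order tie y v t).pulls b + if pulledArm order tie y v t = b then 1 else 0 := by
  change (if b = pulledArm order tie y v t then _ else _) = _
  by_cases h : b = pulledArm order tie y v t
  · simp [← h]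
  · rw [if_neg h, if_neg (Ne.symm h), add_zero]

lemma run_succ_pending (t : ℕ) :
    (run order tie y v (t + 1)).pending =
      (decision order tie (v (t + 1)) (t + 1) (run order tie y v t)).2 := rfl

lemma run_total (t : ℕ) (a : Arm M K) :
    (run order tie y v t).total a =
      ∑ i ∈ Finset.range ((run order tie y v t).pulls a), y a i := by
  induction t with
  | zero => simp [run]
  | succ t ih =>
    simp only [run]
    split_ifs with h
    · rw [Finset.sum_range_succ, ih]
    · exact ih

lemma empMean_run (t : ℕ) (a : Arm M K) :
    (run order tie y v t).empMean a = rewardMean y a ((run order tie y v t).pulls a) := by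
  rw [State.empMean, run_total, rewardMean]

lemma isActive_run (t : ℕ) (a : Arm M K) :
    (run order tie y v t).IsActive a ↔ ActiveAt y a ((run order tie y v t).pulls a) := by
  rw [State.IsActive, empMean_run, ActiveAt]

lemma sum_pulls (t : ℕ) : ∑ a, (run order tie y v t).pulls a = t := by
  induction t with
  | zero => simp [run]
  | succ t ih => simp [run_succ_pulls, Finset.sum_add_distrib, ih]

lemma pulls_eq_sum (t : ℕ) (a : Arm M K) :
    (run order tie y v t).pulls a =
      ∑ s ∈ Finset.range t, if pulledArm order tie y v s = a then 1 else 0 := by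
  induction t with
  | zero => simp [run]
  | succ t ih => rw [run_succ_pulls, Finset.sum_range_succ, ih]

lemma pulls_le (t : ℕ) (a : Arm M K) : (run order tie y v t).pulls a ≤ t := by
  calc _ ≤ ∑ b, (run order tie y v t).pulls b :=
        Finset.single_le_sum (f := fun b => (run order tie y v t).pulls b)
          (fun _ _ => Nat.zero_le _) (Finset.mem_univ a)
    _ = t := sum_pulls ..

lemma pulls_add_pulls_le (t : ℕ) {a b : Arm M K} (hab : a ≠ b) :
    (run order tie y v t).pulls a + (run order tie y v t).pulls b ≤ t := by
  calc _ = ∑ c ∈ {a, b}, (run order tie y v t).pulls c := by rw [Finset.sum_pair hab]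
    _ ≤ ∑ b, (run order tie y v t).pulls b :=
        Finset.sum_le_sum_of_subset (Finset.subset_univ _)
    _ = t := sum_pulls ..

/-- The four kinds of rounds. -/
lemma round_cases [Nonempty (Arm M K)] (hall : ∀ a, a ∈ order) (t : ℕ) :
    (run order tie y v t).pending =
        pulledArm order tie y v t :: (run order tie y v (t + 1)).pending ∨
    (run order tie y v t).Idle ∧
        order = pulledArm order tie y v t :: (run order tie y v (t + 1)).pending ∨
    (∃ m, (run order tie y v t).Single m ∧
        pulledArm order tie y v t = (m, tie (run order tie y v t).pulls
          ((run order tie y v t).ucbArgmax (t + 1) m)) ∧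
        (run order tie y v (t + 1)).pending = []) ∨
    (run order tie y v t).Multi ∧
        pulledArm order tie y v t = v (t + 1) (run order tie y v t).activeArms ∧
        (run order tie y v (t + 1)).pending = [] := by
  rw [run_succ_pending, pulledArm]
  generalize run order tie y v t = s
  rcases hp : s.pending with _ | ⟨a, rest⟩
  · right
    by_cases hc : s.activeCategories = ∅
    · left
      refine ⟨⟨hp, hc⟩, ?_⟩
      rcases horder : order with _ | ⟨a, rest⟩
      · have := hall (Classical.arbitrary _)
        simp [horder] at this
      · simp [decision, hp, hc]
    · right
      by_cases hs : ∃ m, s.activeCategories = {m}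
      · left
        refine ⟨hs.choose, ⟨hp, hs.choose_spec⟩, ?_⟩
        simp [decision, hp, hc, hs]
      · right
        refine ⟨⟨hp, hc, hs⟩, ?_⟩
        simp [decision, hp, hc, hs]
  · left
    simp [decision, hp]

/-- The number of pulls of an arm, where a pending pull counts as done. -/
def claimed (t : ℕ) (a : Arm M K) : ℕ :=
  (run order tie y v t).pulls a + if a ∈ (run order tie y v t).pending then 1 else 0

/-- The number of sweeps started in the first `t` rounds. -/
def sweeps (t : ℕ) : ℕ :=
  1 + ∑ s ∈ Finset.range t, if (run order tie y v s).Idle then 1 else 0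

/-- The number of pulls of an arm in the first `t` rounds while several categories are active. -/
def multiPulls (t : ℕ) (a : Arm M K) : ℕ :=
  ∑ s ∈ Finset.range t,
    if (run order tie y v s).Multi ∧ pulledArm order tie y v s = a then 1 else 0

/-- The number of pulls of an arm in the first `t` rounds by maximization of the index. -/
def ucbPulls (t : ℕ) (a : Arm M K) : ℕ :=
  ∑ s ∈ Finset.range t,
    if (∃ m, (run order tie y v s).Single m) ∧ pulledArm order tie y v s = a then 1 else 0

lemma sweeps_succ (t : ℕ) : sweeps order tie y v (t + 1) =
    sweeps order tie y v t + if (run order tie y v t).Idle then 1 else 0 := by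
  rw [sweeps, Finset.sum_range_succ, ← add_assoc, ← sweeps]

lemma multiPulls_succ (t : ℕ) (a : Arm M K) : multiPulls order tie y v (t + 1) a =
    multiPulls order tie y v t a +
      if (run order tie y v t).Multi ∧ pulledArm order tie y v t = a then 1 else 0 := by
  rw [multiPulls, Finset.sum_range_succ, ← multiPulls]

lemma ucbPulls_succ (t : ℕ) (a : Arm M K) : ucbPulls order tie y v (t + 1) a =
    ucbPulls order tie y v t a +
      if (∃ m, (run order tie y v t).Single m) ∧ pulledArm order tie y v t = a then 1 else 0 := by
  rw [ucbPulls, Finset.sum_range_succ, ← ucbPulls]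

lemma claimed_le (t : ℕ) (a : Arm M K) : claimed order tie y v t a ≤ t + 1 := by
  have := pulls_le order tie y v t a
  unfold claimed
  split_ifs <;> omega

lemma pulls_le_claimed (t : ℕ) (a : Arm M K) :
    (run order tie y v t).pulls a ≤ claimed order tie y v t a := Nat.le_add_right _ _

lemma claimed_of_pending_nil {t : ℕ} (h : (run order tie y v t).pending = []) (a : Arm M K) :
    claimed order tie y v t a = (run order tie y v t).pulls a := by
  simp [claimed, h]

variable {order} (hnodup : order.Nodup) (hall : ∀ a, a ∈ order) [Nonempty (Arm M K)]
include hall hnodup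

lemma pending_nodup (t : ℕ) : (run order tie y v t).pending.Nodup := by
  induction t with
  | zero => exact hnodup
  | succ t ih =>
    rcases round_cases order tie y v hall t with h | ⟨-, h⟩ | ⟨m, -, -, h⟩ | ⟨-, -, h⟩
    · rw [h] at ih
      exact ih.of_cons
    · rw [h] at hnodup
      exact hnodup.of_cons
    · simp [h]
    · simp [h]

/-- Executing a pending pull only moves it from `pending` to `pulls`; since the list has no
duplicates, the arm is not pending afterwards. -/
lemma claimed_succ_of_pending {t : ℕ} (h : (run order tie y v t).pending ≠ []) (a : Arm M K) :
    claimed order tie y v (t + 1) a = claimed order tie y v t a := by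
  rcases round_cases order tie y v hall t with h' | ⟨h', -⟩ | ⟨m, h', -⟩ | ⟨h', -⟩
  · have hn := pending_nodup tie y v hnodup hall t
    rw [claimed, claimed, run_succ_pulls, h']
    rw [h', List.nodup_cons] at hn
    by_cases ha : pulledArm order tie y v t = a
    · subst ha
      simp [hn.1]
    · simp [ha, Ne.symm ha]
  all_goals exact absurd h'.1 h

lemma claimed_succ_of_idle {t : ℕ} (h : (run order tie y v t).Idle) (a : Arm M K) :
    claimed order tie y v (t + 1) a = claimed order tie y v t a + 1 := by
  rcases round_cases order tie y v hall t with h' | ⟨-, h'⟩ | ⟨m, h', -⟩ | ⟨h', -⟩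
  · simp [h.1] at h'
  · have hn := hnodup
    have ha := hall a
    rw [claimed, claimed, run_succ_pulls, h.1]
    rw [h', List.nodup_cons] at hn
    rw [h', List.mem_cons] at ha
    by_cases hc : pulledArm order tie y v t = a
    · subst hc
      simp [hn.1]
    · simp [hc, ha.resolve_left (Ne.symm hc)]
  · exact absurd h h'.not_idle
  · exact absurd h h'.not_idle

omit hnodup in
lemma claimed_succ_of_not_idle {t : ℕ} (h : (run order tie y v t).pending = [])
    (hi : ¬(run order tie y v t).Idle) (a : Arm M K) :
    claimed order tie y v (t + 1) a =
      claimed order tie y v t a + if pulledArm order tie y v t = a then 1 else 0 := by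
  rcases round_cases order tie y v hall t with h' | ⟨h', -⟩ | ⟨m, -, -, h'⟩ | ⟨-, -, h'⟩
  · simp [h] at h'
  · exact absurd h' hi
  all_goals simp [claimed, run_succ_pulls, h', h]

lemma claimed_mono_succ (t : ℕ) (a : Arm M K) :
    claimed order tie y v t a ≤ claimed order tie y v (t + 1) a := by
  by_cases h : (run order tie y v t).pending = []
  · by_cases hi : (run order tie y v t).Idle
    · rw [claimed_succ_of_idle tie y v hnodup hall hi]
      omega
    · rw [claimed_succ_of_not_idle tie y v hall h hi]
      omega
  · rw [claimed_succ_of_pending tie y v hnodup hall h]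

/-- This lets all counts start at `n = 1`. After zero pulls the activity test would read `0 ≤ 0` by
the default values of division and logarithm, and would hold. -/
lemma one_le_claimed (t : ℕ) (a : Arm M K) : 1 ≤ claimed order tie y v t a := by
  induction t with
  | zero => simp [claimed, run, hall a]
  | succ t ih => exact ih.trans (claimed_mono_succ tie y v hnodup hall t a)

/-- Crediting a whole sweep when it starts makes the decomposition exact at every time, even in the
middle of a sweep. The initial sweep is the `1` in `sweeps`. -/
lemma claimed_eq (t : ℕ) (a : Arm M K) :
    claimed order tie y v t a =
      sweeps order tie y v t + multiPulls order tie y v t a + ucbPulls order tie y v t a := by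
  induction t with
  | zero => simp [claimed, run, hall a, sweeps, multiPulls, ucbPulls]
  | succ t ih =>
    rw [sweeps_succ, multiPulls_succ, ucbPulls_succ]
    rcases round_cases order tie y v hall t with h' | ⟨h', -⟩ | ⟨m, h', -⟩ | ⟨h', -⟩
    · have hne : (run order tie y v t).pending ≠ [] := by simp [h']
      rw [claimed_succ_of_pending tie y v hnodup hall hne, if_neg fun h => hne h.1,
        if_neg fun h => hne h.1.1, if_neg fun h => hne h.1.choose_spec.1, ih]
      rfl
    · rw [claimed_succ_of_idle tie y v hnodup hall h', if_pos h',
        if_neg fun h => h.1.not_idle h', if_neg fun h => h.1.choose_spec.not_idle h', ih]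
      omega
    · rw [claimed_succ_of_not_idle tie y v hall h'.1 h'.not_idle, if_neg h'.not_idle,
        ih]
      have hs : ∃ m, (run order tie y v t).Single m := ⟨m, h'⟩
      have hm : ¬(run order tie y v t).Multi := fun h => h.not_single hs
      simp only [hs, hm, true_and, false_and, if_false]
      omega
    · rw [claimed_succ_of_not_idle tie y v hall h'.1 h'.not_idle, if_neg h'.not_idle,
        if_neg (fun h : (∃ m, (run order tie y v t).Single m) ∧ _ => h'.not_single h.1), ih]
      simp only [h', true_and]
      omega

/-- A new sweep starts only if all arms, in particular `a`, are inactive, and it raises `claimed` of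
`a` by one. Different sweeps thus see different inactive pull numbers of `a`. -/
lemma sweeps_le (t : ℕ) (a : Arm M K) :
    sweeps order tie y v t ≤
      1 + countIn (fun n => ¬ActiveAt y a n) 1 (claimed order tie y v t a) := by
  induction t with
  | zero => simp [sweeps]
  | succ t ih =>
    rw [sweeps_succ]
    split_ifs with hi
    · have hin : ¬ActiveAt y a (claimed order tie y v t a) := by
        rw [claimed_of_pending_nil _ _ _ _ hi.1, ← isActive_run]
        intro ha
        have : a.1 ∈ (run order tie y v t).activeCategories := by
          simp only [State.activeCategories, Finset.mem_filter, Finset.mem_univ, true_and]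
          exact ⟨a.2, ha⟩
        simp [hi.2] at this
      rw [claimed_succ_of_idle tie y v hnodup hall hi,
        countIn_succ (one_le_claimed tie y v hnodup hall t a) hin]
      omega
    · refine ih.trans (Nat.add_le_add_left (countIn_mono _ _ ?_) _)
      exact claimed_mono_succ tie y v hnodup hall t a

omit hnodup hall [Nonempty (Arm M K)] in
lemma activeAt_of_multi (hv : ∀ t (S : Finset (Arm M K)), S.Nonempty → v t S ∈ S) {t : ℕ}
    (h : (run order tie y v t).Multi)
    (hp : pulledArm order tie y v t = v (t + 1) (run order tie y v t).activeArms) :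
    ActiveAt y (pulledArm order tie y v t)
      (claimed order tie y v t (pulledArm order tie y v t)) := by
  rw [claimed_of_pending_nil _ _ _ _ h.1, ← isActive_run]
  have hne : (run order tie y v t).activeArms.Nonempty := by
    obtain ⟨m, hm⟩ := Finset.nonempty_iff_ne_empty.2 h.2.1
    simp only [State.activeCategories, Finset.mem_filter, Finset.mem_univ, true_and] at hm
    obtain ⟨k, hk⟩ := hm
    exact ⟨(m, k), by simpa [State.activeArms] using hk⟩
  have := hv (t + 1) _ hne
  rw [← hp] at this
  simpa [State.activeArms] using this

lemma multiPulls_le (hv : ∀ t (S : Finset (Arm M K)), S.Nonempty → v t S ∈ S) (t : ℕ)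
    (a : Arm M K) :
    multiPulls order tie y v t a ≤ countIn (ActiveAt y a) 1 (claimed order tie y v t a) := by
  induction t with
  | zero => simp [multiPulls]
  | succ t ih =>
    rw [multiPulls_succ]
    split_ifs with h
    · rcases round_cases order tie y v hall t with h' | ⟨h', -⟩ | ⟨m, h', -⟩ | ⟨h', hp, -⟩
      · simp [h.1.1] at h'
      · exact absurd h' h.1.not_idle
      · exact absurd ⟨m, h'⟩ h.1.not_single
      · have := activeAt_of_multi tie y v hv h' hp
        rw [h.2] at this
        rw [claimed_succ_of_not_idle tie y v hall h'.1 h'.not_idle, if_pos h.2,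
          countIn_succ (one_le_claimed tie y v hnodup hall t a) this]
        omega
    · exact ih.trans (countIn_mono _ _ (claimed_mono_succ tie y v hnodup hall t a))

omit hnodup hall [Nonempty (Arm M K)] in
lemma ucbIndex_pulledArm_le (htie : ∀ N S, S.Nonempty → tie N S ∈ S) {t : ℕ} {m : Fin M}
    (hp : pulledArm order tie y v t = (m, tie (run order tie y v t).pulls
          ((run order tie y v t).ucbArgmax (t + 1) m))) (k : Fin K) :
    (run order tie y v t).ucbIndex (t + 1) (m, k) ≤
      (run order tie y v t).ucbIndex (t + 1) (pulledArm order tie y v t) := by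
  have hne : ((run order tie y v t).ucbArgmax (t + 1) m).Nonempty := by
    obtain ⟨j, -, hj⟩ := Finset.exists_max_image Finset.univ
      (fun j => (run order tie y v t).ucbIndex (t + 1) (m, j)) ⟨k, Finset.mem_univ k⟩
    exact ⟨j, by simpa [State.ucbArgmax] using fun i => hj i (Finset.mem_univ i)⟩
  have := htie (run order tie y v t).pulls _ hne
  rw [hp]
  simp only [State.ucbArgmax, Finset.mem_filter, Finset.mem_univ, true_and] at this
  exact this k

/-- The arm `a` with `j` pulls can beat the arm `b` in some round until `T`. -/
def Beats (y : Arm M K → ℕ → ℝ) (T : ℕ) (b a : Arm M K) (j : ℕ) : Prop :=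
  ∃ n t : ℕ, 1 ≤ n ∧ n + j + 1 ≤ t ∧ t ≤ T ∧
    rewardMean y b n + 2 * √(Real.log t / n) ≤ rewardMean y a j + 2 * √(Real.log t / j)

/-- Each index pull of `a` exhibits a new pull number at which its index is at least that of `b`.
The two pull counts sum to at most the number of past rounds, whence `n + j + 1 ≤ t` in `Beats`. -/
lemma ucbPulls_le (htie : ∀ N S, S.Nonempty → tie N S ∈ S) {T t : ℕ} (htT : t ≤ T)
    {a b : Arm M K} (hab : a ≠ b) (hcat : a.1 = b.1) :
    ucbPulls order tie y v t a ≤ countIn (Beats y T b a) 1 (claimed order tie y v t a) := by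
  induction t with
  | zero => simp [ucbPulls]
  | succ t ih =>
    specialize ih (by omega)
    rw [ucbPulls_succ]
    split_ifs with h
    · obtain ⟨⟨m', h1⟩, h2⟩ := h
      rcases round_cases order tie y v hall t with h' | ⟨h', -⟩ | ⟨m, h', hp, -⟩ | ⟨h', hp, -⟩
      · simp [h1.1] at h'
      · exact absurd h' h1.not_idle
      · have key : Beats y T b a (claimed order tie y v t a) := by
          refine ⟨claimed order tie y v t b, t + 1, one_le_claimed tie y v hnodup hall t b, ?_,
            htT, ?_⟩
          · rw [claimed_of_pending_nil _ _ _ _ h'.1, claimed_of_pending_nil _ _ _ _ h'.1]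
            have := pulls_add_pulls_le order tie y v t hab
            omega
          · have hm : b = (m, b.2) := by
              rw [h2] at hp
              rw [hp] at hcat
              exact Prod.ext hcat.symm rfl
            have := ucbIndex_pulledArm_le tie y v htie hp b.2
            rw [← hm, h2, State.ucbIndex, State.ucbIndex, empMean_run, empMean_run] at this
            rwa [claimed_of_pending_nil _ _ _ _ h'.1, claimed_of_pending_nil _ _ _ _ h'.1]
        rw [claimed_succ_of_not_idle tie y v hall h'.1 h'.not_idle, if_pos h2,
          countIn_succ (one_le_claimed tie y v hnodup hall t a) key]
        omega
      · exact absurd ⟨m', h1⟩ h'.not_single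
    · exact ih.trans (countIn_mono _ _ (claimed_mono_succ tie y v hnodup hall t a))

-- The function `log x / x` decreases only from `e` on. Starting at `n = 2` is still possible
-- because `log 4 / 4 = log 2 / 2`; the value `N = 3` has to be excluded.
omit hnodup hall [Nonempty (Arm M K)] in
lemma log_div_le_log_div {n N : ℕ} (hn : 2 ≤ n) (hN : 4 ≤ N) (hnN : n ≤ N) :
    Real.log N / N ≤ Real.log n / n := by
  have hanti := Real.log_div_self_antitoneOn
  have he : Real.exp 1 ≤ 3 := by linarith [Real.exp_one_lt_d9]
  have hmem : ∀ k : ℕ, 3 ≤ k → (k : ℝ) ∈ Set.Ici (Real.exp 1) := fun k hk => by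
    have : (3 : ℝ) ≤ k := by exact_mod_cast hk
    exact he.trans this
  rcases hn.eq_or_lt with rfl | hn
  · have h := hanti (hmem 4 (by norm_num)) (hmem N (by omega)) (by exact_mod_cast hN)
    have h4 : Real.log 4 = 2 * Real.log 2 := by
      rw [show (4 : ℝ) = 2 ^ 2 by norm_num, Real.log_pow]
      norm_num
    simp only [Nat.cast_ofNat, h4] at h ⊢
    linarith
  · exact hanti (hmem n hn) (hmem N (by omega)) (by exact_mod_cast hnN)

omit hnodup hall [Nonempty (Arm M K)] in
/-- An inactive arm with at least four pulls that has the larger index than an active arm has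
fewer pulls than the active arm. -/
lemma lt_of_inactive_of_active {a c : Arm M K} {N n t : ℕ} (hN : 4 ≤ N) (hNt : N ≤ t)
    (hn : 1 ≤ n) (ha : ¬ActiveAt y a N) (hc : ActiveAt y c n)
    (h : rewardMean y c n + 2 * √(Real.log t / n) ≤ rewardMean y a N + 2 * √(Real.log t / N)) :
    N < n := by
  by_contra! hnN
  unfold ActiveAt at ha hc
  push Not at ha
  -- The index inequality combined with the two activity thresholds. For `n ≤ N` both terms on the
  -- left should dominate those on the right.
  have hlt : √(Real.log n / n) + √(Real.log t / n) < √(Real.log N / N) + √(Real.log t / N) := by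
    linarith
  have hNR : (4 : ℝ) ≤ N := by exact_mod_cast hN
  have hNtR : (N : ℝ) ≤ t := by exact_mod_cast hNt
  have hnNR : (n : ℝ) ≤ N := by exact_mod_cast hnN
  have hnR : (1 : ℝ) ≤ n := by exact_mod_cast hn
  have hlogt : 0 ≤ Real.log t := Real.log_nonneg (by linarith)
  rcases hn.eq_or_lt with rfl | hn
  -- For `n = 1` the threshold vanishes, but the bonus `√(log t)` alone covers both terms on the
  -- right, each at most half of it because `4 ≤ N ≤ t`.
  · have h1 : √(Real.log N / N) ≤ √(Real.log t) / 2 := by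
      rw [show (2 : ℝ) = √4 by rw [show (4 : ℝ) = 2 ^ 2 by norm_num]; simp,
        ← Real.sqrt_div hlogt]
      have := Real.log_le_log (by linarith) hNtR
      gcongr
    have h2 : √(Real.log t / N) ≤ √(Real.log t) / 2 := by
      rw [show (2 : ℝ) = √4 by rw [show (4 : ℝ) = 2 ^ 2 by norm_num]; simp,
        ← Real.sqrt_div hlogt]
      gcongr
    simp only [Nat.cast_one, Real.log_one, div_one, Real.sqrt_zero] at hlt
    linarith
  · have h1 := Real.sqrt_le_sqrt (log_div_le_log_div hn hN hnN)
    have h2 : √(Real.log t / N) ≤ √(Real.log t / n) := by gcongr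
    linarith

/-- Induction on time for all arms of the category at once. A pull of an active arm with at least
two pulls is paid by its own count. A pull of an inactive arm needs no payment: some active arm of
the category already has more pulls and obeys the bound. -/
lemma claimed_le_of_category (htie : ∀ N S, S.Nonempty → tie N S ∈ S)
    (hv : ∀ t (S : Finset (Arm M K)), S.Nonempty → v t S ∈ S) (t : ℕ) (m : Fin M) (k : Fin K) :
    claimed order tie y v t (m, k) ≤ sweeps order tie y v t + (K + 1) +
      ∑ j, countIn (ActiveAt y (m, j)) 2 (claimed order tie y v t (m, j)) := by
  induction t generalizing k with
  | zero =>
    simp only [claimed, run, hall, sweeps, if_true, Finset.range_zero, Finset.sum_empty]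
    omega
  | succ t ih =>
    have hmono : ∀ j, countIn (ActiveAt y (m, j)) 2 (claimed order tie y v t (m, j)) ≤
        countIn (ActiveAt y (m, j)) 2 (claimed order tie y v (t + 1) (m, j)) := fun j =>
      countIn_mono _ _ (claimed_mono_succ tie y v hnodup hall t _)
    have hsum := Finset.sum_le_sum fun j (_ : j ∈ Finset.univ) => hmono j
    have hsw : 1 ≤ sweeps order tie y v t := Nat.le_add_right _ _
    have hact : pulledArm order tie y v t = (m, k) →
        ActiveAt y (m, k) (claimed order tie y v t (m, k)) →
        claimed order tie y v (t + 1) (m, k) = claimed order tie y v t (m, k) + 1 →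
        K + 1 < claimed order tie y v t (m, k) →
        ∑ j, countIn (ActiveAt y (m, j)) 2 (claimed order tie y v t (m, j)) + 1 ≤
        ∑ j, countIn (ActiveAt y (m, j)) 2 (claimed order tie y v (t + 1) (m, j)) := by
      intro hk ha hcl hlt
      refine Finset.sum_lt_sum (fun j _ => hmono j) ⟨k, Finset.mem_univ k, ?_⟩
      rw [hcl, countIn_succ (by omega) ha]
      omega
    have ihk := ih k
    rw [sweeps_succ]
    rcases round_cases order tie y v hall t with h' | ⟨h', -⟩ | ⟨m', h', hp, -⟩ | ⟨h', hp, -⟩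
    · have hne : (run order tie y v t).pending ≠ [] := by simp [h']
      rw [claimed_succ_of_pending tie y v hnodup hall hne (m, k)]
      omega
    · rw [claimed_succ_of_idle tie y v hnodup hall h' (m, k), if_pos h']
      omega
    · have hcl := claimed_succ_of_not_idle tie y v hall h'.1 h'.not_idle (m, k)
      by_cases hk : pulledArm order tie y v t = (m, k)
      · rw [if_pos hk] at hcl
        by_cases hlt : K + 1 < claimed order tie y v t (m, k)
        · by_cases ha : ActiveAt y (m, k) (claimed order tie y v t (m, k))
          · have := hact hk ha hcl hlt
            omega
          · have hm : m' = m := by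
              have := hp.symm.trans hk
              exact congrArg Prod.fst this
            subst hm
            have hmem : m' ∈ (run order tie y v t).activeCategories := by simp [h'.2]
            simp only [State.activeCategories, Finset.mem_filter, Finset.mem_univ, true_and]
              at hmem
            obtain ⟨j, hj⟩ := hmem
            rw [isActive_run, ← claimed_of_pending_nil _ _ _ _ h'.1] at hj
            have hjk : j ≠ k := by
              rintro rfl
              exact ha hj
            -- Two distinct arms force `K ≥ 2`, so more than `K + 1` pulls means at least four, as
            -- the comparison with the active arm requires.
            have hK : 2 ≤ K := by
              have h1 := j.2
              have h2 := k.2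
              have h3 : (j : ℕ) ≠ k := fun h => hjk (Fin.ext h)
              omega
            have hidx := ucbIndex_pulledArm_le tie y v htie hp j
            rw [hk, State.ucbIndex, State.ucbIndex, empMean_run, empMean_run,
              ← claimed_of_pending_nil _ _ _ _ h'.1, ← claimed_of_pending_nil _ _ _ _ h'.1]
              at hidx
            have := lt_of_inactive_of_active y (by omega) (claimed_le order tie y v t (m', k))
              (one_le_claimed tie y v hnodup hall t (m', j)) ha hj hidx
            have := ih j
            omega
        · omega
      · rw [if_neg hk] at hcl
        omega
    · have hcl := claimed_succ_of_not_idle tie y v hall h'.1 h'.not_idle (m, k)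
      by_cases hk : pulledArm order tie y v t = (m, k)
      · rw [if_pos hk] at hcl
        by_cases hlt : K + 1 < claimed order tie y v t (m, k)
        · have ha := activeAt_of_multi tie y v hv h' hp
          rw [hk] at ha
          have := hact hk ha hcl hlt
          omega
        · omega
      · rw [if_neg hk] at hcl
        omega

end Path

/-! ### Deterministic estimates for sums of tail bounds. -/

/-- Comparison with the integral, as a telescoping sum; one step is `x ≤ exp x - 1`. -/
lemma sum_Ioc_exp_neg_mul_le {x : ℝ} (hx : 0 < x) {a b : ℕ} (hab : a ≤ b) :
    ∑ n ∈ Finset.Ioc a b, Real.exp (-(n * x)) ≤ Real.exp (-(a * x)) / x := by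
  suffices h : ∑ n ∈ Finset.Ioc a b, Real.exp (-(n * x)) ≤
      (Real.exp (-(a * x)) - Real.exp (-(b * x))) / x from
    h.trans (by gcongr; linarith [Real.exp_pos (-(b * x))])
  induction b, hab using Nat.le_induction with
  | base => simp
  | succ b hab ih =>
    rw [← Finset.insert_Ioc_right_eq_Ioc_add_one hab, Finset.sum_insert (by simp)]
    have h1 : Real.exp (-(b * x)) = Real.exp (-((b + 1 : ℕ) * x)) * Real.exp x := by
      rw [← Real.exp_add]
      push_cast
      ring_nf
    have h2 : Real.exp (-((b + 1 : ℕ) * x)) ≤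
        (Real.exp (-(b * x)) - Real.exp (-((b + 1 : ℕ) * x))) / x := by
      rw [le_div_iff₀ hx, h1]
      nlinarith [Real.add_one_le_exp x, Real.exp_pos (-((b + 1 : ℕ) * x))]
    calc _ ≤ (Real.exp (-(b * x)) - Real.exp (-((b + 1 : ℕ) * x))) / x +
          (Real.exp (-(a * x)) - Real.exp (-(b * x))) / x := add_le_add h2 ih
      _ = _ := by ring

lemma sum_Icc_one_exp_neg_mul_le {x : ℝ} (hx : 0 < x) (T : ℕ) :
    ∑ n ∈ Finset.Icc 1 T, Real.exp (-(n * x)) ≤ 1 / x := by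
  simpa [← Finset.Icc_add_one_left_eq_Ioc] using sum_Ioc_exp_neg_mul_le hx (Nat.zero_le T)

lemma sum_Ico_inv_sq_le {x : ℝ} (hx : 0 ≤ x) {a b : ℕ} (ha : 1 ≤ a) (hab : a ≤ b) :
    ∑ j ∈ Finset.Ico a b, ((x + j + 1) ^ 2)⁻¹ ≤ 1 / (x + a) := by
  have ha' : (1 : ℝ) ≤ a := by exact_mod_cast ha
  suffices h : ∑ j ∈ Finset.Ico a b, ((x + j + 1) ^ 2)⁻¹ ≤ 1 / (x + a) - 1 / (x + b) from
    h.trans (sub_le_self _ (by positivity))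
  induction b, hab using Nat.le_induction with
  | base => simp
  | succ b hab ih =>
    have hb : (1 : ℝ) ≤ b := ha'.trans (by exact_mod_cast hab)
    rw [← Finset.insert_Ico_right_eq_Ico_add_one hab, Finset.sum_insert (by simp)]
    have h2 : ((x + b + 1) ^ 2)⁻¹ ≤ 1 / (x + b) - 1 / (x + b + 1) := by
      rw [div_sub_div _ _ (by positivity) (by positivity), inv_eq_one_div]
      rw [div_le_div_iff₀ (by positivity) (by positivity)]
      nlinarith
    push_cast
    rw [← add_assoc]
    linarith

lemma sum_Icc_one_inv_sq_le (T : ℕ) : ∑ n ∈ Finset.Icc 1 T, ((n : ℝ) ^ 2)⁻¹ ≤ Real.pi ^ 2 / 6 := by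
  have := sum_le_hasSum (Finset.Icc 1 T) (fun n _ => by positivity) hasSum_zeta_two
  simpa using this

lemma sum_Icc_two_inv_sq_le (T : ℕ) :
    ∑ n ∈ Finset.Icc 2 T, ((n : ℝ) ^ 2)⁻¹ ≤ Real.pi ^ 2 / 6 - 1 := by
  have := sum_le_hasSum (insert 1 (Finset.Icc 2 T)) (fun n _ => by positivity) hasSum_zeta_two
  rw [Finset.sum_insert (by simp)] at this
  simp only [one_div, Nat.cast_one, one_pow, inv_one] at this
  linarith

lemma log_le_div_exp_one {x : ℝ} (hx : 0 < x) : Real.log x ≤ x / Real.exp 1 := by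
  have := Real.log_le_sub_one_of_pos (show 0 < x / Real.exp 1 by positivity)
  rw [Real.log_div hx.ne' (Real.exp_pos 1).ne', Real.log_exp] at this
  linarith

lemma log_div_self_le_inv {c x : ℝ} (hc : Real.exp 1 ≤ c) (hx : 2 * c * Real.log c ≤ x) :
    Real.log x / x ≤ 1 / c := by
  have he : 2 < Real.exp 1 := by linarith [Real.exp_one_gt_d9]
  have hc0 : 0 < c := by linarith
  have hlog : 1 ≤ Real.log c := by
    rw [Real.le_log_iff_exp_le hc0]
    exact hc
  set z := 2 * c * Real.log c with hz
  have hz0 : 0 < z := by positivity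
  have hx0 : 0 < x := hz0.trans_le hx
  -- The tangent of `log` at `z` reduces the claim for all `x ≥ z` to `log z ≤ 2 * log c` and `c ≤
  -- z`.
  have h1 : Real.log x ≤ Real.log z + (x / z - 1) := by
    have := Real.log_le_sub_one_of_pos (div_pos hx0 hz0)
    rw [Real.log_div hx0.ne' hz0.ne'] at this
    linarith
  have h2 : Real.log z ≤ 2 * Real.log c := by
    have h3 : 2 * Real.log c ≤ c := by
      have := log_le_div_exp_one hc0
      have h4 : c / Real.exp 1 ≤ c / 2 := by gcongr
      linarith
    rw [hz, show 2 * c * Real.log c = c * (2 * Real.log c) by ring,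
      Real.log_mul hc0.ne' (by positivity)]
    have := Real.log_le_log (by positivity) h3
    linarith
  have h5 : c * (x / z - 1) ≤ x - z := by
    rw [show c * (x / z - 1) = (x - z) * (c / z) by field_simp]
    have : c / z ≤ 1 := by
      rw [div_le_one hz0]
      nlinarith
    nlinarith
  rw [div_le_div_iff₀ hx0 hc0]
  nlinarith

/-- The number of `n` that violate `log n / n ≤ 1 / c`. -/
lemma card_log_div_self_gt_le {c : ℝ} (hc : 0 < c) (T : ℕ) :
    (((Finset.Icc 1 T).filter fun n : ℕ => ¬Real.log n / n ≤ 1 / c).card : ℝ) ≤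
      1 + 2 * c * Real.log c := by
  have he : 2 < Real.exp 1 := by linarith [Real.exp_one_gt_d9]
  rcases le_total c (Real.exp 1) with hce | hce
  -- As `log x / x` never exceeds `1 / e`, nothing is counted when `c ≤ e`. The summand `1` keeps
  -- the right side nonnegative where `log c < 0`.
  · rw [Finset.card_eq_zero.2]
    · have h1 := log_le_div_exp_one (inv_pos.2 hc)
      rw [Real.log_inv] at h1
      have h2 : c⁻¹ / Real.exp 1 ≤ c⁻¹ / 2 := by gcongr
      have h3 : c * (c⁻¹ / 2) = 1 / 2 := by field_simp
      have h4 := mul_le_mul_of_nonneg_left (h1.trans h2) hc.le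
      push_cast
      linarith
    · rw [Finset.filter_eq_empty_iff]
      intro n hn
      rw [not_not]
      have hn0 : (0 : ℝ) < n := by exact_mod_cast (Finset.mem_Icc.1 hn).1
      have h1 := log_le_div_exp_one hn0
      have h2 : (n : ℝ) / Real.exp 1 ≤ n / c := by gcongr
      rw [div_le_iff₀ hn0]
      linarith [show (1 / c * n : ℝ) = n / c by ring]
  · have hlog : 0 ≤ 2 * c * Real.log c :=
      mul_nonneg (by positivity) (Real.log_nonneg (by linarith))
    have hsub : ((Finset.Icc 1 T).filter fun n : ℕ => ¬Real.log n / n ≤ 1 / c) ⊆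
        Finset.Icc 1 ⌊2 * c * Real.log c⌋₊ := by
      intro n hn
      rw [Finset.mem_filter, Finset.mem_Icc] at hn
      rw [Finset.mem_Icc]
      refine ⟨hn.1.1, Nat.le_floor ?_⟩
      by_contra! h
      exact hn.2 (log_div_self_le_inv hce h.le)
    have hcard := Finset.card_le_card hsub
    rw [Nat.card_Icc, Nat.add_sub_cancel] at hcard
    have : (((Finset.Icc 1 T).filter fun n : ℕ => ¬Real.log n / n ≤ 1 / c).card : ℝ) ≤
      ⌊2 * c * Real.log c⌋₊ := by exact_mod_cast hcard
    linarith [Nat.floor_le hlog]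

lemma sum_le_of_log_div_self_le {c : ℝ} (hc : 0 < c) (T : ℕ) {q : ℕ → ℝ} (hq1 : ∀ n, q n ≤ 1)
    (hq : ∀ n : ℕ, 1 ≤ n → Real.log n / n ≤ 1 / c → q n ≤ Real.exp (-(n * (2 / c)))) :
    ∑ n ∈ Finset.Icc 1 T, q n ≤ 1 + 2 * c * Real.log c + c / 2 := by
  calc ∑ n ∈ Finset.Icc 1 T, q n
      ≤ ∑ n ∈ Finset.Icc 1 T, ((if ¬Real.log n / n ≤ 1 / c then (1 : ℝ) else 0) +
          Real.exp (-(n * (2 / c)))) := by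
        refine Finset.sum_le_sum fun n hn => ?_
        by_cases h : Real.log n / n ≤ 1 / c
        · rw [if_neg (not_not.2 h), zero_add]
          exact hq n (Finset.mem_Icc.1 hn).1 h
        · rw [if_pos h]
          linarith [hq1 n, Real.exp_pos (-(n * (2 / c)))]
    _ = (((Finset.Icc 1 T).filter fun n : ℕ => ¬Real.log n / n ≤ 1 / c).card : ℝ) +
          ∑ n ∈ Finset.Icc 1 T, Real.exp (-(n * (2 / c))) := by
        rw [Finset.sum_add_distrib, Finset.sum_boole]
    _ ≤ (1 + 2 * c * Real.log c) + 1 / (2 / c) :=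
        add_le_add (card_log_div_self_gt_le hc T) (sum_Icc_one_exp_neg_mul_le (by positivity) T)
    _ = _ := by rw [one_div_div]

/-- The first `⌊u⌋` terms are bounded by `1` each, and the tail estimate applies beyond them. The
cases `T ≤ 6` and `T ≤ u` are trivial; otherwise `T ≥ 7` makes `log T` large enough for the
remainder to be at most `4`. -/
lemma sum_le_of_deviation_bounds {D : ℝ} (hD : 0 < D) (T : ℕ) {q : ℕ → ℝ} (hq1 : ∀ j, q j ≤ 1)
    (hq0 : ∀ j, T < j + 2 → q j = 0)
    (hq : ∀ j : ℕ, 1 ≤ j → 16 * Real.log T / D ^ 2 < j → q j ≤ Real.exp (-(j * (D ^ 2 / 16))) +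
      ∑ n ∈ Finset.Icc 1 T, Real.exp (-(n * (D ^ 2 / 98))) * (((n : ℝ) + j + 1) ^ 2)⁻¹) :
    ∑ j ∈ Finset.Icc 1 T, q j ≤ 16 * Real.log T / D ^ 2 + 4 := by
  set u := 16 * Real.log T / D ^ 2 with hu
  have hu0 : 0 ≤ u := by
    have := Real.log_natCast_nonneg T
    positivity
  have htriv : ∀ N : ℕ, ∑ j ∈ Finset.Icc 1 N, q j ≤ N := fun N => by
    simpa using Finset.sum_le_card_nsmul (Finset.Icc 1 N) q 1 fun j _ => hq1 j
  rcases le_or_gt T 6 with hT | hT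
  -- At most `T - 2 ≤ 4` terms are nonzero.
  · have : ∑ j ∈ Finset.Icc 1 T, q j = ∑ j ∈ Finset.Icc 1 (T - 2), q j := by
      refine (Finset.sum_subset (Finset.Icc_subset_Icc_right (Nat.sub_le _ _)) ?_).symm
      intro j hj hj'
      rw [Finset.mem_Icc] at hj hj'
      exact hq0 j (by omega)
    rw [this]
    have h4 : ((T - 2 : ℕ) : ℝ) ≤ 4 := by exact_mod_cast (by omega : T - 2 ≤ 4)
    linarith [htriv (T - 2)]
  rcases le_or_gt (T : ℝ) u with huT | huT
  · linarith [htriv T]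
  have hT7 : (7 : ℝ) ≤ T := by exact_mod_cast hT
  have hL : 1.9 ≤ Real.log T := by
    have h1 := Real.log_le_log (by norm_num) hT7
    -- This yields `log 7 ≥ 3 * log 2 - 1 / 7 > 1.9`.
    have h2 := Real.log_le_sub_one_of_pos (show (0 : ℝ) < 8 / 7 by norm_num)
    rw [Real.log_div (by norm_num) (by norm_num), show (8 : ℝ) = 2 ^ 3 by norm_num,
      Real.log_pow] at h2
    have h3 := Real.log_two_gt_d9
    norm_num at h2 h3 ⊢
    linarith
  have hupos : 0 < u := by positivity
  set j₀ := ⌊u⌋₊ + 1 with hj₀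
  have huj : u < j₀ := by
    rw [hj₀]
    exact_mod_cast Nat.lt_floor_add_one u
  have hjT : j₀ ≤ T := (Nat.floor_lt hu0).2 huT
  have hfl : (⌊u⌋₊ : ℝ) ≤ u := Nat.floor_le hu0
  have hsplit : ∑ j ∈ Finset.Icc 1 T, q j =
      ∑ j ∈ Finset.Icc 1 ⌊u⌋₊, q j + ∑ j ∈ Finset.Ico j₀ (T + 1), q j := by
    rw [← Finset.Ico_add_one_right_eq_Icc, ← Finset.Ico_add_one_right_eq_Icc,
      Finset.sum_Ico_consecutive _ (by omega) (by omega)]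
  have hexp : ∑ j ∈ Finset.Ico j₀ (T + 1), Real.exp (-(j * (D ^ 2 / 16))) ≤
      1 / T + 1 / Real.log T := by
    have h1 : Real.exp (-(j₀ * (D ^ 2 / 16))) ≤ 1 / T := by
      have hTexp : (1 : ℝ) / T = Real.exp (-Real.log T) := by
        rw [Real.exp_neg, Real.exp_log (by linarith), one_div]
      rw [hTexp, Real.exp_le_exp, neg_le_neg_iff]
      have : u * (D ^ 2 / 16) = Real.log T := by
        rw [hu]
        field_simp
      rw [← this]
      gcongr
    have h2 : 1 / (D ^ 2 / 16) ≤ T / Real.log T := by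
      rw [le_div_iff₀ (by linarith)]
      calc _ = u := by rw [hu]; field_simp
        _ ≤ T := huT.le
    rw [Finset.sum_eq_sum_Ico_succ_bot (by omega), Finset.Ico_add_one_add_one_eq_Ioc]
    calc _ ≤ Real.exp (-(j₀ * (D ^ 2 / 16))) + Real.exp (-(j₀ * (D ^ 2 / 16))) / (D ^ 2 / 16) :=
          add_le_add le_rfl (sum_Ioc_exp_neg_mul_le (by positivity) hjT)
      _ = Real.exp (-(j₀ * (D ^ 2 / 16))) +
          Real.exp (-(j₀ * (D ^ 2 / 16))) * (1 / (D ^ 2 / 16)) := by ring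
      _ ≤ 1 / T + 1 / T * (T / Real.log T) := by gcongr
      _ = _ := by
        have : (T : ℝ) ≠ 0 := by linarith
        field_simp
  have hdouble : ∑ j ∈ Finset.Ico j₀ (T + 1), ∑ n ∈ Finset.Icc 1 T,
      Real.exp (-(n * (D ^ 2 / 98))) * (((n : ℝ) + j + 1) ^ 2)⁻¹ ≤ 49 / 8 / Real.log T := by
    rw [Finset.sum_comm]
    calc _ ≤ ∑ n ∈ Finset.Icc 1 T, Real.exp (-(n * (D ^ 2 / 98))) * (1 / u) := by
          refine Finset.sum_le_sum fun n _ => ?_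
          rw [← Finset.mul_sum]
          gcongr
          refine (sum_Ico_inv_sq_le (Nat.cast_nonneg n) (by omega) (by omega)).trans ?_
          gcongr
          have : (0 : ℝ) ≤ n := Nat.cast_nonneg n
          linarith
      _ ≤ 1 / (D ^ 2 / 98) * (1 / u) := by
          rw [← Finset.sum_mul]
          gcongr
          exact sum_Icc_one_exp_neg_mul_le (by positivity) T
      _ = _ := by
          rw [hu]
          field_simp
          norm_num
  have hrest : ∑ j ∈ Finset.Ico j₀ (T + 1), q j ≤ 4 := by
    calc _ ≤ ∑ j ∈ Finset.Ico j₀ (T + 1), (Real.exp (-(j * (D ^ 2 / 16))) +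
      ∑ n ∈ Finset.Icc 1 T, Real.exp (-(n * (D ^ 2 / 98))) * (((n : ℝ) + j + 1) ^ 2)⁻¹) := by
          refine Finset.sum_le_sum fun j hj => hq j ?_ ?_
          · have := (Finset.mem_Ico.1 hj).1
            omega
          · have : (j₀ : ℝ) ≤ j := by exact_mod_cast (Finset.mem_Ico.1 hj).1
            linarith
      _ ≤ (1 / T + 1 / Real.log T) + 49 / 8 / Real.log T := by
          rw [Finset.sum_add_distrib]
          exact add_le_add hexp hdouble
      _ ≤ (1 / 7 + 1 / 1.9) + 49 / 8 / 1.9 := by gcongr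
      _ ≤ 4 := by norm_num
  linarith [htriv ⌊u⌋₊]

/-! ### Measurability and tail probabilities of the pull-number events. -/

lemma measurable_rewardMean {Ω : Type*} [MeasurableSpace Ω] {Y : Arm M K → ℕ → Ω → ℝ}
    (hY : ∀ a n, Measurable (Y a n)) (a : Arm M K) (n : ℕ) :
    Measurable fun ω => rewardMean (fun a n => Y a n ω) a n := by
  unfold rewardMean
  exact (Finset.measurable_sum _ fun i _ => hY a i).div_const _

lemma measurableSet_activeAt {Ω : Type*} [MeasurableSpace Ω] {Y : Arm M K → ℕ → Ω → ℝ}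
    (hY : ∀ a n, Measurable (Y a n)) (a : Arm M K) (n : ℕ) :
    MeasurableSet {ω | ActiveAt (fun a n => Y a n ω) a n} :=
  measurableSet_le measurable_const (measurable_rewardMean hY a n)

lemma measurableSet_beats {Ω : Type*} [MeasurableSpace Ω] {Y : Arm M K → ℕ → Ω → ℝ}
    (hY : ∀ a n, Measurable (Y a n)) (T : ℕ) (b a : Arm M K) (j : ℕ) :
    MeasurableSet {ω | Beats (fun a n => Y a n ω) T b a j} := by
  have : {ω | Beats (fun a n => Y a n ω) T b a j} =
      ⋃ n : ℕ, ⋃ t : ℕ, {ω | 1 ≤ n ∧ n + j + 1 ≤ t ∧ t ≤ T ∧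
        rewardMean (fun a n => Y a n ω) b n + 2 * √(Real.log t / n) ≤
          rewardMean (fun a n => Y a n ω) a j + 2 * √(Real.log t / j)} := by
    ext ω
    simp [Beats]
  rw [this]
  refine MeasurableSet.iUnion fun n => MeasurableSet.iUnion fun t => ?_
  exact (MeasurableSet.const _).inter ((MeasurableSet.const _).inter ((MeasurableSet.const _).inter
    (measurableSet_le ((measurable_rewardMean hY b n).add_const _)
      ((measurable_rewardMean hY a j).add_const _))))

section Tail

variable {Ω : Type*} [MeasurableSpace Ω] {P : Measure Ω} {ν : Arm M K → Measure ℝ} {Y : Arm M K → ℕ → Ω → ℝ}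
  {V : ℕ → Finset (Arm M K) → Ω → Arm M K}

lemma rewardMean_sub {y : Arm M K → ℕ → ℝ} {a : Arm M K} {n : ℕ} (hn : 1 ≤ n) (x : ℝ) :
    n * (rewardMean y a n - x) = ∑ i ∈ Finset.range n, (y a i - x) := by
  have : (n : ℝ) ≠ 0 := by positivity
  rw [rewardMean, Finset.sum_sub_distrib]
  simp
  field_simp

lemma exp_neg_sq_div {n : ℕ} (hn : 1 ≤ n) (ε : ℝ) :
    Real.exp (-(n * ε) ^ 2 / (2 * n * (1 : NNReal))) = Real.exp (-(n * ε ^ 2 / 2)) := by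
  congr 1
  have : (n : ℝ) ≠ 0 := by positivity
  simp
  field_simp

variable (hν : ∀ a, HasSubgaussianMGF (fun x : ℝ => x - armMean ν a) 1 (ν a))
  (hrand : IsRandomness P ν Y V)
include hν hrand

lemma hasSubgaussianMGF_reward (a : Arm M K) (i : ℕ) :
    HasSubgaussianMGF (fun ω => Y a i ω - armMean ν a) 1 P := by
  have h := hν a
  rw [← hrand.law_reward a i] at h
  exact h.of_map (hrand.measurable_reward a i).aemeasurable

lemma measureReal_le_rewardMean_sub (a : Arm M K) {n : ℕ} (hn : 1 ≤ n) {ε : ℝ} (hε : 0 ≤ ε) :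
    P.real {ω | ε ≤ rewardMean (fun a n => Y a n ω) a n - armMean ν a} ≤
      Real.exp (-(n * ε ^ 2 / 2)) := by
  have hind : iIndepFun (fun i ω => Y a i ω - armMean ν a) P :=
    (hrand.indep_rewards.precomp (g := fun i : ℕ => (a, i)) (Prod.mk_right_injective a)).comp
      (fun _ x => x - armMean ν a) fun _ => measurable_id.sub_const _
  have h := HasSubgaussianMGF.measure_sum_range_ge_le_of_iIndepFun hind (n := n)
    (fun i _ => hasSubgaussianMGF_reward hν hrand a i) (ε := n * ε) (by positivity)
  rw [exp_neg_sq_div hn] at h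
  convert! h using 4 with ω
  have hn' : (0 : ℝ) < n := by positivity
  rw [← rewardMean_sub (y := fun a n => Y a n ω) hn, mul_le_mul_iff_right₀ hn']

lemma measureReal_le_sub_rewardMean (a : Arm M K) {n : ℕ} (hn : 1 ≤ n) {ε : ℝ} (hε : 0 ≤ ε) :
    P.real {ω | ε ≤ armMean ν a - rewardMean (fun a n => Y a n ω) a n} ≤
      Real.exp (-(n * ε ^ 2 / 2)) := by
  have hind : iIndepFun (fun i ω => -(Y a i ω - armMean ν a)) P :=
    (hrand.indep_rewards.precomp (g := fun i : ℕ => (a, i)) (Prod.mk_right_injective a)).comp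
      (fun _ x => -(x - armMean ν a)) fun _ => (measurable_id.sub_const _).neg
  have h := HasSubgaussianMGF.measure_sum_range_ge_le_of_iIndepFun hind (n := n)
    (fun i _ => (hasSubgaussianMGF_reward hν hrand a i).neg) (ε := n * ε) (by positivity)
  rw [exp_neg_sq_div hn] at h
  convert! h using 4 with ω
  have hn' : (0 : ℝ) < n := by positivity
  rw [Finset.sum_neg_distrib, ← rewardMean_sub (y := fun a n => Y a n ω) hn, ← mul_neg, neg_sub,
    mul_le_mul_iff_right₀ hn']

/-- The threshold `2 * √(log n / n)` is chosen so that the sub-Gaussian exponent is exactly `2 * log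
n`. -/
lemma measureReal_activeAt_le [IsProbabilityMeasure P] {a : Arm M K} (ha : armMean ν a ≤ 0) {n : ℕ} (hn : 1 ≤ n) :
    P.real {ω | ActiveAt (fun a n => Y a n ω) a n} ≤ ((n : ℝ) ^ 2)⁻¹ := by
  have hn' : (0 : ℝ) < n := by positivity
  have hlog : 0 ≤ Real.log n / n := div_nonneg (Real.log_natCast_nonneg n) hn'.le
  refine (measureReal_mono ?_).trans ((measureReal_le_rewardMean_sub hν hrand a hn
    (ε := 2 * √(Real.log n / n)) (by positivity)).trans_eq ?_)
  · intro ω hω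
    simp only [ActiveAt, Set.mem_ofPred_eq] at hω ⊢
    linarith
  · rw [mul_pow, Real.sq_sqrt hlog,
      show -(n * (2 ^ 2 * (Real.log n / n)) / 2) = -(2 * Real.log n) by field_simp,
      Real.exp_neg, two_mul, Real.exp_add, Real.exp_log hn', sq]

/-- The condition on `n` puts the threshold at or below half the mean, so inactivity requires a
downward deviation of at least half the mean. -/
lemma measureReal_not_activeAt_le [IsProbabilityMeasure P] {a : Arm M K} (ha : 0 < armMean ν a) {n : ℕ} (hn : 1 ≤ n)
    (hlog : Real.log n / n ≤ 1 / (16 / armMean ν a ^ 2)) :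
    P.real {ω | ¬ActiveAt (fun a n => Y a n ω) a n} ≤
      Real.exp (-(n * (2 / (16 / armMean ν a ^ 2)))) := by
  refine (measureReal_mono ?_).trans ((measureReal_le_sub_rewardMean hν hrand a hn
    (ε := armMean ν a / 2) (by positivity)).trans_eq ?_)
  · intro ω hω
    simp only [ActiveAt, Set.mem_ofPred_eq] at hω ⊢
    have : √(Real.log n / n) ≤ armMean ν a / 4 := by
      refine Real.sqrt_le_iff.2 ⟨by positivity, hlog.trans_eq ?_⟩
      field_simp
      norm_num
    linarith
  · congr 1
    field_simp
    norm_num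

lemma measureReal_beats_le [IsProbabilityMeasure P] {a b : Arm M K} (hgap : 0 < gap ν b a) {T j : ℕ} (hj : 1 ≤ j)
    (hTj : 16 * Real.log T / gap ν b a ^ 2 < j) :
    P.real {ω | Beats (fun a n => Y a n ω) T b a j} ≤
      Real.exp (-(j * (gap ν b a ^ 2 / 16))) + ∑ n ∈ Finset.Icc 1 T,
        Real.exp (-(n * (gap ν b a ^ 2 / 98))) * (((n : ℝ) + j + 1) ^ 2)⁻¹ := by
  set D := gap ν b a with hD
  have hj' : (0 : ℝ) < j := by positivity
  have hsub : {ω | Beats (fun a n => Y a n ω) T b a j} ⊆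
      -- The gap is split as `5 / 14 + 1 / 7 + 1 / 2 = 1`: deviation of `a`, deviation of `b` beyond
      -- its bonus, and the bonus of `a`, which is at most `D / 2` for these `j`. The exponents are
      -- `25 / 392 ≥ 1 / 16` and `1 / 98`; the bonus of `b` supplies the factor `(n + j + 1) ^
      -- (-2)`.
      {ω | 5 * D / 14 ≤ rewardMean (fun a n => Y a n ω) a j - armMean ν a} ∪
      ⋃ n ∈ Finset.Icc 1 T, {ω | D / 7 + 2 * √(Real.log (n + j + 1 : ℝ) / n) ≤
        armMean ν b - rewardMean (fun a n => Y a n ω) b n} := by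
    rintro ω ⟨n, t, hn, hnt, htT, h⟩
    rw [Set.mem_union, or_iff_not_imp_left]
    intro hlow
    rw [Set.mem_ofPred_eq, not_le] at hlow
    refine Set.mem_biUnion (x := n) (by simp; omega) ?_
    rw [Set.mem_ofPred_eq]
    have hn' : (0 : ℝ) < n := by positivity
    have hntR : (n + j + 1 : ℝ) ≤ t := by exact_mod_cast hnt
    have htTR : (t : ℝ) ≤ T := by exact_mod_cast htT
    have h1 : √(Real.log t / j) ≤ D / 4 := by
      refine Real.sqrt_le_iff.2 ⟨by positivity, ?_⟩
      have hl := Real.log_le_log (by linarith) htTR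
      rw [div_lt_iff₀ (by positivity)] at hTj
      rw [div_le_iff₀ hj']
      nlinarith
    have h2 : √(Real.log (n + j + 1 : ℝ) / n) ≤ √(Real.log t / n) := by
      have hl := Real.log_le_log (by positivity) hntR
      gcongr
    have h3 : armMean ν a = armMean ν b - D := by rw [hD, gap]; ring
    linarith
  refine (measureReal_mono hsub).trans ((measureReal_union_le _ _).trans (add_le_add ?_ ?_))
  · refine (measureReal_le_rewardMean_sub hν hrand a hj (by positivity)).trans ?_
    rw [Real.exp_le_exp, neg_le_neg_iff]
    have : 0 ≤ (j : ℝ) * D ^ 2 := by positivity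
    nlinarith
  · refine (measureReal_biUnion_finset_le _ _).trans (Finset.sum_le_sum fun n hn => ?_)
    have hn1 := (Finset.mem_Icc.1 hn).1
    have hn' : (0 : ℝ) < n := by positivity
    have hx : (0 : ℝ) < n + j + 1 := by positivity
    have hlog : 0 ≤ Real.log (n + j + 1 : ℝ) / n :=
      div_nonneg (Real.log_nonneg (by linarith)) hn'.le
    refine (measureReal_le_sub_rewardMean hν hrand b hn1 (by positivity)).trans ?_
    have hsq : ((n + j + 1 : ℝ) ^ 2)⁻¹ = Real.exp (-(2 * Real.log (n + j + 1 : ℝ))) := by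
      rw [Real.exp_neg, two_mul, Real.exp_add, Real.exp_log hx, sq]
    rw [hsq, ← Real.exp_add, Real.exp_le_exp, ← neg_add, neg_le_neg_iff]
    set s := √(Real.log (n + j + 1 : ℝ) / n) with hs
    have hs0 : 0 ≤ s := Real.sqrt_nonneg _
    have hs2 : n * s ^ 2 = Real.log (n + j + 1 : ℝ) := by
      rw [hs, Real.sq_sqrt hlog]
      field_simp
    -- The cross term of `(D / 7 + 2 * s) ^ 2` is discarded.
    have h4 : 0 ≤ n * (D * s) := by positivity
    rw [← hs2]
    nlinarith

omit hν in
lemma ae_draw_mem : ∀ᵐ ω ∂P, ∀ t (S : Finset (Arm M K)), S.Nonempty → V t S ω ∈ S := by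
  rw [ae_all_iff]
  intro t
  rw [ae_all_iff]
  intro S
  by_cases hS : S.Nonempty
  · have h : P {ω | V t S ω ∉ S} = 0 := by
      have h1 : P.map (V t S) (S : Set (Arm M K))ᶜ = 0 := by
        rw [hrand.law_draw t S hS, uniformOn_eq_zero_iff S.finite_toSet]
        simp
      rwa [Measure.map_apply (hrand.measurable_draw t S) S.measurableSet.compl] at h1
    filter_upwards [measure_eq_zero_iff_ae_notMem.1 h] with ω hω _
    simpa using hω
  · exact Filter.Eventually.of_forall fun ω h => absurd h hS

omit hν in
lemma measureReal_draw {t : ℕ} {S : Finset (Arm M K)} {a b : Arm M K} (ha : a ∈ S) (hb : b ∈ S) :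
    P.real (V t S ⁻¹' {a}) = P.real (V t S ⁻¹' {b}) := by
  have h : ∀ c ∈ S, P (V t S ⁻¹' {c}) = 1 / S.card := by
    intro c hc
    rw [← Measure.map_apply (hrand.measurable_draw t S) (measurableSet_singleton c),
      hrand.law_draw t S ⟨c, hc⟩]
    have := uniformOn_apply_finset (s := S) (t := {c})
    rw [Finset.coe_singleton] at this
    rw [this, Finset.inter_singleton_of_mem hc]
    simp
  rw [measureReal_def, measureReal_def, h a ha, h b hb]

end Tail

/-! ### Measurability of the run and its independence of the next draw. -/

/-- If `X` is independent of `(Y, Z)` and `Y` of `Z`, then `(X, Y)` is independent of `Z`. -/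
lemma indepFun_prodMk_left {Ω α β γ : Type*} [MeasurableSpace Ω] [MeasurableSpace α]
    [MeasurableSpace β] [MeasurableSpace γ] {P : Measure Ω} [IsProbabilityMeasure P]
    {X : Ω → α} {Y : Ω → β} {Z : Ω → γ} (hX : Measurable X) (hY : Measurable Y)
    (hZ : Measurable Z) (h : IndepFun X (fun ω => (Y ω, Z ω)) P) (hYZ : IndepFun Y Z P) :
    IndepFun (fun ω => (X ω, Y ω)) Z P := by
  have := Measure.isProbabilityMeasure_map (μ := P) hX.aemeasurable
  have := Measure.isProbabilityMeasure_map (μ := P) hY.aemeasurable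
  have := Measure.isProbabilityMeasure_map (μ := P) hZ.aemeasurable
  have hXY : IndepFun X Y P := h.comp measurable_id measurable_fst
  rw [indepFun_iff_map_prod_eq_prod_map_map hX.aemeasurable (hY.prodMk hZ).aemeasurable,
    (indepFun_iff_map_prod_eq_prod_map_map hY.aemeasurable hZ.aemeasurable).1 hYZ] at h
  rw [indepFun_iff_map_prod_eq_prod_map_map (hX.prodMk hY).aemeasurable hZ.aemeasurable,
    (indepFun_iff_map_prod_eq_prod_map_map hX.aemeasurable hY.aemeasurable).1 hXY]
  have hassoc := (measurePreserving_prodAssoc (P.map X) (P.map Y) (P.map Z)).symm.map_eq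
  rw [← hassoc, ← h, Measure.map_map (by fun_prop) (by fun_prop)]
  rfl

lemma run_congr (order : List (Arm M K)) (tie : (Arm M K → ℕ) → Finset (Fin K) → Fin K)
    (y : Arm M K → ℕ → ℝ) {v v' : ℕ → Finset (Arm M K) → Arm M K} {t : ℕ}
    (h : ∀ s ≤ t, v s = v' s) : run order tie y v t = run order tie y v' t := by
  induction t with
  | zero => rfl
  | succ t ih => simp only [run, ih fun s hs => h s (by omega), h (t + 1) le_rfl]

/-- The finite information from which the decision is computed. -/
abbrev DecisionCode (M K : ℕ) : Type :=
  List (Arm M K) × Finset (Fin M) × (Arm M K → ℕ) × (Fin M → Finset (Fin K)) × Arm M K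

/-- The decision as a function of its code. -/
def DecisionCode.eval (order : List (Arm M K))
    (tie : (Arm M K → ℕ) → Finset (Fin K) → Fin K) (c : DecisionCode M K) :
    Arm M K × List (Arm M K) :=
  let todo := if c.1 = [] ∧ c.2.1 = ∅ then order else c.1
  match todo with
  | a :: rest => (a, rest)
  | [] =>
    if h : ∃ m, c.2.1 = {m} then
      ((h.choose, tie c.2.2.1 (c.2.2.2.1 h.choose)), [])
    else (c.2.2.2.2, [])

lemma decision_eq_eval (order : List (Arm M K)) (tie : (Arm M K → ℕ) → Finset (Fin K) → Fin K)
    (v : Finset (Arm M K) → Arm M K) (t : ℕ) (s : State M K) :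
    decision order tie v t s = DecisionCode.eval order tie
      (s.pending, s.activeCategories, s.pulls, s.ucbArgmax t, v s.activeArms) := rfl

section Measurability

variable {Ω : Type*} [MeasurableSpace Ω]

/-- Measurability of a random state, component by component. -/
structure IsMeasurableState (s : Ω → State M K) : Prop where
  pulls : ∀ a, Measurable fun ω => (s ω).pulls a
  total : ∀ a, Measurable fun ω => (s ω).total a
  pending : ∀ l, MeasurableSet {ω | (s ω).pending = l}

lemma measurableSet_eq_of_mem_iff {ι : Type*} [Fintype ι] {f : Ω → Finset ι}
    (h : ∀ i, MeasurableSet {ω | i ∈ f ω}) (S : Finset ι) : MeasurableSet {ω | f ω = S} := by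
  have : {ω | f ω = S} = ⋂ i, {ω | i ∈ f ω ↔ i ∈ S} := by
    ext ω
    simp [Finset.ext_iff]
  rw [this]
  exact MeasurableSet.iInter fun i => (h i).iff (MeasurableSet.const _)

variable {s : Ω → State M K}

lemma IsMeasurableState.empMean (hs : IsMeasurableState s) (a : Arm M K) :
    Measurable fun ω => (s ω).empMean a := by
  unfold State.empMean
  exact (hs.total a).div (measurable_from_top.comp (hs.pulls a))

lemma IsMeasurableState.isActive (hs : IsMeasurableState s) (a : Arm M K) :
    MeasurableSet {ω | (s ω).IsActive a} :=
  measurableSet_le ((measurable_from_top (f := fun n : ℕ => 2 * √(Real.log n / n))).comp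
    (hs.pulls a)) (hs.empMean a)

lemma IsMeasurableState.activeArms (hs : IsMeasurableState s) (S : Finset (Arm M K)) :
    MeasurableSet {ω | (s ω).activeArms = S} :=
  measurableSet_eq_of_mem_iff (fun a => by simpa [State.activeArms] using hs.isActive a) S

lemma IsMeasurableState.activeCategories (hs : IsMeasurableState s) (S : Finset (Fin M)) :
    MeasurableSet {ω | (s ω).activeCategories = S} := by
  refine measurableSet_eq_of_mem_iff (fun m => ?_) S
  have : {ω | m ∈ (s ω).activeCategories} = ⋃ k, {ω | (s ω).IsActive (m, k)} := by
    ext ω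
    simp [State.activeCategories]
  rw [this]
  exact MeasurableSet.iUnion fun k => hs.isActive _

lemma IsMeasurableState.ucbIndex (hs : IsMeasurableState s) (t : ℕ) (a : Arm M K) :
    Measurable fun ω => (s ω).ucbIndex t a :=
  (hs.empMean a).add ((measurable_from_top
    (f := fun n : ℕ => 2 * √(Real.log (t : ℝ) / n))).comp (hs.pulls a))

lemma IsMeasurableState.ucbArgmax (hs : IsMeasurableState s) (t : ℕ) (m : Fin M)
    (S : Finset (Fin K)) : MeasurableSet {ω | (s ω).ucbArgmax t m = S} := by
  refine measurableSet_eq_of_mem_iff (fun k => ?_) S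
  have : {ω | k ∈ (s ω).ucbArgmax t m} =
      ⋂ j, {ω | (s ω).ucbIndex t (m, j) ≤ (s ω).ucbIndex t (m, k)} := by
    ext ω
    simp [State.ucbArgmax]
  rw [this]
  exact MeasurableSet.iInter fun j => measurableSet_le (hs.ucbIndex t _) (hs.ucbIndex t _)

lemma IsMeasurableState.multi (hs : IsMeasurableState s) : MeasurableSet {ω | (s ω).Multi} := by
  have : {ω | (s ω).Multi} = {ω | (s ω).pending = []} ∩ ({ω | (s ω).activeCategories = ∅}ᶜ ∩
      (⋃ m, {ω | (s ω).activeCategories = {m}})ᶜ) := by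
    ext ω
    simp [State.Multi]
  rw [this]
  exact (hs.pending []).inter ((hs.activeCategories ∅).compl.inter
    (MeasurableSet.iUnion fun m => hs.activeCategories {m}).compl)

/-- The decision depends on the real-valued rewards only through a code from a countable type, so
the event is a countable union over codes. This needs no measurability of `tie`. -/
lemma IsMeasurableState.decision (hs : IsMeasurableState s) {v : Ω → Finset (Arm M K) → Arm M K}
    (hv : ∀ S, Measurable fun ω => v ω S) (order : List (Arm M K))
    (tie : (Arm M K → ℕ) → Finset (Fin K) → Fin K) (t : ℕ) (D : Set (Arm M K × List (Arm M K))) :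
    MeasurableSet {ω | decision order tie (v ω) t (s ω) ∈ D} := by
  have : {ω | CategorizedBandit.decision order tie (v ω) t (s ω) ∈ D} =
      ⋃ c ∈ {c | DecisionCode.eval order tie c ∈ D}, {ω | (s ω).pending = c.1} ∩
        ({ω | (s ω).activeCategories = c.2.1} ∩ ((⋂ a, {ω | (s ω).pulls a = c.2.2.1 a}) ∩
        ((⋂ m, {ω | (s ω).ucbArgmax t m = c.2.2.2.1 m}) ∩
        ⋃ S, {ω | (s ω).activeArms = S} ∩ {ω | v ω S = c.2.2.2.2}))) := by
    ext ω
    simp only [Set.mem_ofPred_eq, decision_eq_eval, Set.mem_iUnion, Set.mem_inter_iff,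
      Set.mem_iInter, exists_prop]
    constructor
    · intro h
      exact ⟨_, h, rfl, rfl, fun _ => rfl, fun _ => rfl, _, rfl, rfl⟩
    · rintro ⟨⟨c₁, c₂, c₃, c₄, c₅⟩, hc, h₁, h₂, h₃, h₄, S, rfl, h₅⟩
      convert hc using 2
      rw [h₁, h₂, funext h₃, funext h₄, h₅]
  rw [this]
  refine MeasurableSet.biUnion (Set.to_countable _) fun c _ => ?_
  refine (hs.pending _).inter ((hs.activeCategories _).inter ((MeasurableSet.iInter fun a => ?_).inter
    ((MeasurableSet.iInter fun m => hs.ucbArgmax t m _).inter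
    (MeasurableSet.iUnion fun S => (hs.activeArms S).inter ?_))))
  · exact hs.pulls a (measurableSet_singleton _)
  · exact hv S (measurableSet_singleton _)

variable {Y : Arm M K → ℕ → Ω → ℝ} {V : ℕ → Finset (Arm M K) → Ω → Arm M K}
  (hY : ∀ a n, Measurable (Y a n)) (hV : ∀ t S, Measurable (V t S))
  (order : List (Arm M K)) (tie : (Arm M K → ℕ) → Finset (Fin K) → Fin K)
include hY hV

lemma isMeasurableState_run (t : ℕ) : IsMeasurableState fun ω =>
    run order tie (fun a n => Y a n ω) (fun t S => V t S ω) t := by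
  induction t with
  | zero => exact ⟨fun _ => measurable_const, fun _ => measurable_const, fun l =>
      MeasurableSet.const (order = l)⟩
  | succ t ih =>
    have hd := ih.decision (hV (t + 1)) order tie (t + 1)
    refine ⟨fun a => ?_, fun a => ?_, fun l => hd {d | d.2 = l}⟩
    · exact Measurable.ite (hd {d | a = d.1}) ((ih.pulls a).add_const 1) (ih.pulls a)
    · refine Measurable.ite (hd {d | a = d.1}) ((ih.total a).add ?_) (ih.total a)
      -- The reward index is itself random; joint measurability holds because it ranges over a
      -- countable set.
      have h : Measurable fun p : ℕ × Ω => Y a p.1 p.2 :=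
        measurable_from_prod_countable_right fun n => hY a n
      exact h.comp ((ih.pulls a).prodMk measurable_id)

lemma measurableSet_pulledArm (t : ℕ) (a : Arm M K) : MeasurableSet
    {ω | pulledArm order tie (fun a n => Y a n ω) (fun t S => V t S ω) t = a} :=
  (isMeasurableState_run hY hV order tie t).decision (hV (t + 1)) order tie (t + 1) {d | d.1 = a}

end Measurability

section Draws

variable {Ω : Type*} [MeasurableSpace Ω] {P : Measure Ω} [IsProbabilityMeasure P]
  {ν : Arm M K → Measure ℝ} {Y : Arm M K → ℕ → Ω → ℝ} {V : ℕ → Finset (Arm M K) → Ω → Arm M K}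
  (hrand : IsRandomness P ν Y V)
include hrand

/-- The rewards and the draws of the first rounds are independent of the next draw. -/
lemma indepFun_past_draw (t : ℕ) (S : Finset (Arm M K)) :
    IndepFun (fun ω => ((fun p : Arm M K × ℕ => Y p.1 p.2 ω),
      fun (s : Finset.range (t + 1)) (S : Finset (Arm M K)) => V s S ω)) (V (t + 1) S) P := by
  have hV : ∀ t, Measurable fun ω (S : Finset (Arm M K)) => V t S ω := fun t =>
    measurable_pi_lambda _ fun S => hrand.measurable_draw t S
  refine indepFun_prodMk_left ?_ ?_ (hrand.measurable_draw _ S) ?_ ?_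
  · exact measurable_pi_lambda _ fun p => hrand.measurable_reward p.1 p.2
  · exact measurable_pi_lambda _ fun s => hV s
  · exact hrand.indep_rewards_draws.comp (φ := id)
      (ψ := fun d : ℕ × Finset (Arm M K) → Arm M K =>
        ((fun (s : Finset.range (t + 1)) (S : Finset (Arm M K)) => d (s, S)), d (t + 1, S)))
      measurable_id (by fun_prop)
  · have h := hrand.indep_draws.indepFun_finset (Finset.range (t + 1)) {t + 1} (by simp) hV
    exact h.comp (φ := id) (ψ := fun d : (({t + 1} : Finset ℕ) →
      Finset (Arm M K) → Arm M K) => d ⟨t + 1, by simp⟩ S) measurable_id (by fun_prop)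

/-- Conditionally on the past, each active arm is drawn with the same probability. -/
lemma measureReal_multi_inter_draw [Nonempty (Arm M K)] (order : List (Arm M K))
    (tie : (Arm M K → ℕ) → Finset (Fin K) → Fin K) (t : ℕ) {S : Finset (Arm M K)} {a b : Arm M K}
    (ha : a ∈ S) (hb : b ∈ S) :
    P.real ({ω | (run order tie (fun a n => Y a n ω) (fun t S => V t S ω) t).Multi ∧
        (run order tie (fun a n => Y a n ω) (fun t S => V t S ω) t).activeArms = S} ∩
        V (t + 1) S ⁻¹' {a}) =
      P.real ({ω | (run order tie (fun a n => Y a n ω) (fun t S => V t S ω) t).Multi ∧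
        (run order tie (fun a n => Y a n ω) (fun t S => V t S ω) t).activeArms = S} ∩
        V (t + 1) S ⁻¹' {b}) := by
  -- Draws after round `t` are replaced by a constant, which exhibits the state as a function of the
  -- past alone.
  let v' : (Finset.range (t + 1) → Finset (Arm M K) → Arm M K) → ℕ → Finset (Arm M K) → Arm M K :=
    fun d s S => if h : s ∈ Finset.range (t + 1) then d ⟨s, h⟩ S else Classical.arbitrary _
  let E : Set ((Arm M K × ℕ → ℝ) × (Finset.range (t + 1) → Finset (Arm M K) → Arm M K)) :=
    {x | (run order tie (fun a n => x.1 (a, n)) (v' x.2) t).Multi ∧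
      (run order tie (fun a n => x.1 (a, n)) (v' x.2) t).activeArms = S}
  have hE : MeasurableSet E := by
    have hs := isMeasurableState_run
      (Y := fun a n (x : (Arm M K × ℕ → ℝ) × (Finset.range (t + 1) → Finset (Arm M K) → Arm M K)) =>
        x.1 (a, n)) (V := fun s S x => v' x.2 s S) (by fun_prop) (fun s S => by
          by_cases h : s ∈ Finset.range (t + 1)
          · simp only [v', dif_pos h]
            fun_prop
          · simp only [v', dif_neg h]
            exact measurable_const) order tie t
    exact hs.multi.inter (hs.activeArms S)
  have hset : {ω | (run order tie (fun a n => Y a n ω) (fun t S => V t S ω) t).Multi ∧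
        (run order tie (fun a n => Y a n ω) (fun t S => V t S ω) t).activeArms = S} =
      (fun ω => ((fun p : Arm M K × ℕ => Y p.1 p.2 ω),
        fun (s : Finset.range (t + 1)) (S : Finset (Arm M K)) => V s S ω)) ⁻¹' E := by
    ext ω
    have : run order tie (fun a n => Y a n ω) (fun t S => V t S ω) t =
        run order tie (fun a n => Y a n ω) (v' fun s S => V s S ω) t := by
      refine run_congr order tie _ fun s hs => ?_
      funext S
      simp only [v', Finset.mem_range]
      rw [dif_pos (by omega)]
    simp only [Set.mem_ofPred_eq, Set.mem_preimage, E, this]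
  have hind := indepFun_past_draw hrand t S
  rw [hset, measureReal_def, measureReal_def,
    hind.measure_inter_preimage_eq_mul _ _ hE (measurableSet_singleton a),
    hind.measure_inter_preimage_eq_mul _ _ hE (measurableSet_singleton b),
    ENNReal.toReal_mul, ENNReal.toReal_mul, ← measureReal_def, ← measureReal_def,
    ← measureReal_def, measureReal_draw hrand ha hb]

end Draws

lemma pulledArm_of_multi (order : List (Arm M K)) (tie : (Arm M K → ℕ) → Finset (Fin K) → Fin K)
    (y : Arm M K → ℕ → ℝ) (v : ℕ → Finset (Arm M K) → Arm M K) {t : ℕ}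
    (h : (run order tie y v t).Multi) :
    pulledArm order tie y v t = v (t + 1) (run order tie y v t).activeArms := by
  simp [pulledArm, decision, h.1, h.2.1, h.2.2]

/-- If several categories are active, some active arm is outside of a given category. -/
lemma State.Multi.exists_activeArm {s : State M K} (h : s.Multi) (m₁ : Fin M) :
    ∃ b ∈ s.activeArms, b.1 ≠ m₁ := by
  by_contra! hall
  refine h.2.2 ⟨m₁, Finset.eq_singleton_iff_nonempty_unique_mem.2
    ⟨Finset.nonempty_iff_ne_empty.2 h.2.1, fun m hm => ?_⟩⟩
  simp only [State.activeCategories, Finset.mem_filter, Finset.mem_univ, true_and] at hm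
  obtain ⟨k, hk⟩ := hm
  exact hall (m, k) (by simpa [State.activeArms] using hk)

lemma sum_filter_fst_ne (m₁ : Fin M) (x : ℝ) :
    ∑ _b ∈ Finset.univ.filter (fun b : Arm M K => b.1 ≠ m₁), x = ((M : ℝ) - 1) * K * x := by
  have : Finset.univ.filter (fun b : Arm M K => b.1 ≠ m₁) =
      (Finset.univ.erase m₁) ×ˢ (Finset.univ : Finset (Fin K)) := by
    ext b
    simp
  rw [this, Finset.sum_const, Finset.card_product, Finset.card_erase_of_mem (Finset.mem_univ _)]
  simp [Nat.cast_sub (show 1 ≤ M from m₁.pos)]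

/-! ### Expected numbers of pulls. -/

section Expectation

variable {Ω : Type*} [MeasurableSpace Ω] {P : Measure Ω} [IsProbabilityMeasure P]

lemma integrable_sum_ite {ι : Type*} (s : Finset ι) {p : ι → Ω → Prop}
    [∀ i ω, Decidable (p i ω)] (hp : ∀ i, MeasurableSet {ω | p i ω}) :
    Integrable (fun ω => ((∑ i ∈ s, if p i ω then 1 else 0 : ℕ) : ℝ)) P ∧
      ∫ ω, ((∑ i ∈ s, if p i ω then 1 else 0 : ℕ) : ℝ) ∂P = ∑ i ∈ s, P.real {ω | p i ω} := by
  have h : ∀ i, (fun ω => if p i ω then (1 : ℝ) else 0) = Set.indicator {ω | p i ω} 1 := by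
    intro i
    ext ω
    by_cases hi : p i ω <;> simp [hi]
  have hint : ∀ i, Integrable (fun ω => if p i ω then (1 : ℝ) else 0) P := fun i => by
    rw [h]
    exact (integrable_const (1 : ℝ)).indicator (hp i)
  push_cast
  refine ⟨integrable_finsetSum _ fun i _ => hint i, ?_⟩
  rw [integral_finsetSum _ fun i _ => hint i]
  refine Finset.sum_congr rfl fun i _ => ?_
  rw [h, integral_indicator_one (hp i)]

lemma integrable_countIn {p : Ω → ℕ → Prop} (hp : ∀ n, MeasurableSet {ω | p ω n}) (lo hi : ℕ) :
    Integrable (fun ω => (countIn (p ω) lo hi : ℝ)) P ∧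
      ∫ ω, (countIn (p ω) lo hi : ℝ) ∂P = ∑ n ∈ Finset.Ico lo hi, P.real {ω | p ω n} := by
  simp only [countIn, Finset.card_filter]
  exact integrable_sum_ite _ hp

variable {ν : Arm M K → Measure ℝ} {Y : Arm M K → ℕ → Ω → ℝ}
  {V : ℕ → Finset (Arm M K) → Ω → Arm M K} (hrand : IsRandomness P ν Y V)
  (order : List (Arm M K)) (tie : (Arm M K → ℕ) → Finset (Fin K) → Fin K)
include hrand

/-- Split by the set `S` of active arms. Either `a` is outside `S` and is almost surely not drawn,
or it is as likely as some arm of `S` outside the category `m₁`, which exists since several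
categories are active. -/
lemma measureReal_multi_pulledArm_le [Nonempty (Arm M K)] (m₁ : Fin M) (a : Arm M K) (t : ℕ) :
    P.real {ω | (run order tie (fun a n => Y a n ω) (fun t S => V t S ω) t).Multi ∧
        pulledArm order tie (fun a n => Y a n ω) (fun t S => V t S ω) t = a} ≤
      ∑ b ∈ Finset.univ.filter (fun b : Arm M K => b.1 ≠ m₁),
        P.real {ω | (run order tie (fun a n => Y a n ω) (fun t S => V t S ω) t).Multi ∧
          pulledArm order tie (fun a n => Y a n ω) (fun t S => V t S ω) t = b} := by
  have hs := isMeasurableState_run hrand.measurable_reward hrand.measurable_draw order tie t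
  let E : Finset (Arm M K) → Set Ω := fun S =>
    {ω | (run order tie (fun a n => Y a n ω) (fun t S => V t S ω) t).Multi ∧
        (run order tie (fun a n => Y a n ω) (fun t S => V t S ω) t).activeArms = S}
  have hE : ∀ S, MeasurableSet (E S) := fun S => hs.multi.inter (hs.activeArms S)
  have hsplit : ∀ c : Arm M K,
      P.real {ω | (run order tie (fun a n => Y a n ω) (fun t S => V t S ω) t).Multi ∧
        pulledArm order tie (fun a n => Y a n ω) (fun t S => V t S ω) t = c} =
      ∑ S, P.real (E S ∩ V (t + 1) S ⁻¹' {c}) := by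
    intro c
    rw [← measureReal_iUnion_fintype]
    · congr 1
      ext ω
      simp only [Set.mem_ofPred_eq, Set.mem_iUnion, Set.mem_inter_iff, Set.mem_preimage,
        Set.mem_singleton_iff, E]
      constructor
      · rintro ⟨h, hp⟩
        exact ⟨_, ⟨h, rfl⟩, by rw [← hp, pulledArm_of_multi _ _ _ _ h]⟩
      · rintro ⟨S, ⟨h, rfl⟩, hp⟩
        exact ⟨h, by rw [← hp, pulledArm_of_multi _ _ _ _ h]⟩
    · intro S S' hSS'
      refine Set.disjoint_left.2 fun ω h h' => hSS' ?_
      exact h.1.2.symm.trans h'.1.2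
    · exact fun S => (hE S).inter (hrand.measurable_draw _ S (measurableSet_singleton c))
  simp only [hsplit]
  rw [Finset.sum_comm]
  refine Finset.sum_le_sum fun S _ => ?_
  rcases (E S).eq_empty_or_nonempty with hemp | ⟨ω, hω, rfl⟩
  · simp [hemp]
  obtain ⟨b, hb, hbm⟩ := hω.exists_activeArm m₁
  set S := (run order tie (fun a n => Y a n ω) (fun t S => V t S ω) t).activeArms
  by_cases ha : a ∈ S
  · calc _ = P.real (E S ∩ V (t + 1) S ⁻¹' {b}) :=
          measureReal_multi_inter_draw hrand order tie t ha hb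
      _ ≤ _ := Finset.single_le_sum (f := fun b => P.real (E S ∩ V (t + 1) S ⁻¹' {b}))
          (fun _ _ => measureReal_nonneg) (by simpa using hbm)
  · have h0 : P.real (E S ∩ V (t + 1) S ⁻¹' {a}) = 0 := by
      rw [measureReal_def, measure_mono_null (t := {ω | ¬V (t + 1) S ω ∈ S})]
      · rfl
      · rintro ω ⟨-, hω⟩ hmem
        rw [Set.mem_preimage, Set.mem_singleton_iff] at hω
        exact ha (hω ▸ hmem)
      · refine ae_iff.1 ?_
        filter_upwards [ae_draw_mem hrand] with ω hω
        exact hω (t + 1) S ⟨b, hb⟩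
    rw [h0]
    exact Finset.sum_nonneg fun _ _ => measureReal_nonneg

lemma integrable_multiPulls (T : ℕ) (a : Arm M K) :
    Integrable (fun ω => (multiPulls order tie (fun a n => Y a n ω) (fun t S => V t S ω) T a : ℝ))
      P ∧
    ∫ ω, (multiPulls order tie (fun a n => Y a n ω) (fun t S => V t S ω) T a : ℝ) ∂P =
      ∑ t ∈ Finset.range T, P.real
        {ω | (run order tie (fun a n => Y a n ω) (fun t S => V t S ω) t).Multi ∧
          pulledArm order tie (fun a n => Y a n ω) (fun t S => V t S ω) t = a} :=
  integrable_sum_ite (Finset.range T)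
    (p := fun t ω => (run order tie (fun a n => Y a n ω) (fun t S => V t S ω) t).Multi ∧
      pulledArm order tie (fun a n => Y a n ω) (fun t S => V t S ω) t = a) fun t =>
    ((isMeasurableState_run hrand.measurable_reward hrand.measurable_draw order tie t).multi).inter
      (measurableSet_pulledArm hrand.measurable_reward hrand.measurable_draw order tie t a)

lemma integrable_pulls (T : ℕ) (a : Arm M K) : Integrable
    (fun ω => ((run order tie (fun a n => Y a n ω) (fun t S => V t S ω) T).pulls a : ℝ)) P := by
  simp only [pulls_eq_sum]
  exact (integrable_sum_ite (Finset.range T)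
    (p := fun t ω => pulledArm order tie (fun a n => Y a n ω) (fun t S => V t S ω) t = a) fun t =>
      measurableSet_pulledArm hrand.measurable_reward hrand.measurable_draw order tie t a).1

variable (hν : ∀ a, HasSubgaussianMGF (fun x : ℝ => x - armMean ν a) 1 (ν a))
include hν

/-- The expected number of visits of the rewards of an arm with positive mean to the inactive
region. -/
lemma integral_countIn_not_activeAt_le {a : Arm M K} (ha : 0 < armMean ν a) (T : ℕ) :
    ∫ ω, (countIn (fun n => ¬ActiveAt (fun a n => Y a n ω) a n) 1 (T + 1) : ℝ) ∂P ≤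
      1 + 32 / armMean ν a ^ 2 * Real.log (16 / armMean ν a ^ 2) + 8 / armMean ν a ^ 2 := by
  rw [(integrable_countIn (p := fun ω n => ¬ActiveAt (fun a n => Y a n ω) a n)
    (fun n => (measurableSet_activeAt hrand.measurable_reward a n).compl) 1 (T + 1)).2,
    Finset.Ico_add_one_right_eq_Icc]
  refine (sum_le_of_log_div_self_le (c := 16 / armMean ν a ^ 2) (by positivity) T
    (fun n => measureReal_le_one) fun n hn h =>
      measureReal_not_activeAt_le hν hrand ha hn h).trans_eq ?_
  ring

lemma integral_countIn_beats_le {a b : Arm M K} (hgap : 0 < gap ν b a) (T : ℕ) :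
    ∫ ω, (countIn (Beats (fun a n => Y a n ω) T b a) 1 (T + 1) : ℝ) ∂P ≤
      16 * Real.log T / gap ν b a ^ 2 + 4 := by
  rw [(integrable_countIn (fun n => measurableSet_beats hrand.measurable_reward T b a n) 1
    (T + 1)).2, Finset.Ico_add_one_right_eq_Icc]
  refine sum_le_of_deviation_bounds hgap T (fun _ => measureReal_le_one) (fun j hj => ?_)
    fun j hj hTj => measureReal_beats_le hν hrand hgap hj hTj
  have : {ω | Beats (fun a n => Y a n ω) T b a j} = ∅ := by
    refine Set.eq_empty_of_forall_notMem fun ω hω => ?_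
    obtain ⟨n, t, h1, h2, h3, -⟩ := hω
    omega
  rw [this, measureReal_empty]

lemma integral_countIn_activeAt_le {a : Arm M K} (ha : armMean ν a ≤ 0) (T : ℕ) :
    ∫ ω, (countIn (ActiveAt (fun a n => Y a n ω) a) 1 (T + 1) : ℝ) ∂P ≤ Real.pi ^ 2 / 6 := by
  rw [(integrable_countIn (fun n => measurableSet_activeAt hrand.measurable_reward a n) 1
    (T + 1)).2, Finset.Ico_add_one_right_eq_Icc]
  exact (Finset.sum_le_sum fun n hn => measureReal_activeAt_le hν hrand ha
    (Finset.mem_Icc.1 hn).1).trans (sum_Icc_one_inv_sq_le T)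

/-- Omitting `n = 1` saves `1` per arm; summed over a category this cancels the `K` in
`claimed_le_of_category`. -/
lemma integral_countIn_two_activeAt_le {a : Arm M K} (ha : armMean ν a ≤ 0) (T : ℕ) :
    ∫ ω, (countIn (ActiveAt (fun a n => Y a n ω) a) 2 (T + 1) : ℝ) ∂P ≤ Real.pi ^ 2 / 6 - 1 := by
  rw [(integrable_countIn (fun n => measurableSet_activeAt hrand.measurable_reward a n) 2
    (T + 1)).2, Finset.Ico_add_one_right_eq_Icc]
  exact (Finset.sum_le_sum fun n hn => measureReal_activeAt_le hν hrand ha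
    (one_le_two.trans (Finset.mem_Icc.1 hn).1)).trans (sum_Icc_two_inv_sq_le T)

variable {order} {tie} (hnodup : order.Nodup) (hall : ∀ a, a ∈ order) {m₁ : Fin M} {k₁ : Fin K}
  (hdom : GroupSparse ν m₁)
include hnodup hall hdom

lemma integral_multiPulls_le [Nonempty (Arm M K)] (T : ℕ) (a : Arm M K) :
    ∫ ω, (multiPulls order tie (fun a n => Y a n ω) (fun t S => V t S ω) T a : ℝ) ∂P ≤
      ((M : ℝ) - 1) * K * (Real.pi ^ 2 / 6) := by
  calc _ ≤ ∑ b ∈ Finset.univ.filter (fun b : Arm M K => b.1 ≠ m₁),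
        ∫ ω, (multiPulls order tie (fun a n => Y a n ω) (fun t S => V t S ω) T b : ℝ) ∂P := by
        simp only [(integrable_multiPulls hrand order tie T _).2]
        rw [Finset.sum_comm]
        exact Finset.sum_le_sum fun t _ => measureReal_multi_pulledArm_le hrand order tie m₁ a t
    _ ≤ ∑ _b ∈ Finset.univ.filter (fun b : Arm M K => b.1 ≠ m₁), Real.pi ^ 2 / 6 := by
        refine Finset.sum_le_sum fun b hb => ?_
        have hb' : armMean ν b ≤ 0 := hdom.2 b.1 (Finset.mem_filter.1 hb).2 b.2
        refine (integral_mono_ae (integrable_multiPulls hrand order tie T b).1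
          (integrable_countIn (fun n => measurableSet_activeAt hrand.measurable_reward b n) 1
            (T + 1)).1 ?_).trans (integral_countIn_activeAt_le hrand hν hb' T)
        filter_upwards [ae_draw_mem hrand] with ω hω
        exact_mod_cast (multiPulls_le tie _ _ hnodup hall hω T b).trans
          (countIn_mono _ _ (claimed_le ..))
    _ = _ := sum_filter_fst_ne m₁ _

omit hdom in
/-- The expected number of pulls of a suboptimal arm of the category of a good arm. -/
lemma integral_pulls_le_of_same_category (hdom : GroupSparse ν m₁)
    (htie : ∀ N S, S.Nonempty → tie N S ∈ S) (hpos : 0 < armMean ν (m₁, k₁)) {k : Fin K}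
    (hgap : 0 < gap ν (m₁, k₁) (m₁, k)) (T : ℕ) :
    ∫ ω, ((run order tie (fun a n => Y a n ω) (fun t S => V t S ω) T).pulls (m₁, k) : ℝ) ∂P ≤
      16 * Real.log T / gap ν (m₁, k₁) (m₁, k) ^ 2 +
      (6 + 32 / armMean ν (m₁, k₁) ^ 2 * Real.log (16 / armMean ν (m₁, k₁) ^ 2) +
        8 / armMean ν (m₁, k₁) ^ 2) + ((M : ℝ) - 1) * K * (Real.pi ^ 2 / 6) := by
  have : Nonempty (Arm M K) := ⟨(m₁, k₁)⟩
  have hne : (m₁, k) ≠ (m₁, k₁) := by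
    intro h
    rw [h, gap, sub_self] at hgap
    exact hgap.false
  have h1 := (integrable_countIn (P := P) (p := fun ω n =>
    ¬ActiveAt (fun a n => Y a n ω) (m₁, k₁) n) (fun n =>
      (measurableSet_activeAt hrand.measurable_reward (m₁, k₁) n).compl) 1 (T + 1)).1
  have h2 := (integrable_multiPulls hrand order tie T (m₁, k)).1
  have h3 := (integrable_countIn (P := P) (fun n => measurableSet_beats hrand.measurable_reward T
    (m₁, k₁) (m₁, k) n) 1 (T + 1)).1
  -- The constant `6` is `1` for the initial sweep, `1` from the inactivity count and `4` from the
  -- index pulls.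
  have h4 := ((integrable_const (1 : ℝ)).add h1).add (h2.add h3)
  refine (integral_mono (integrable_pulls hrand order tie T (m₁, k)) h4 fun ω => ?_).trans ?_
  · have e1 := claimed_eq tie (fun a n => Y a n ω) (fun t S => V t S ω) hnodup hall T (m₁, k)
    have e2 := pulls_le_claimed order tie (fun a n => Y a n ω) (fun t S => V t S ω) T (m₁, k)
    have e3 := (sweeps_le tie (fun a n => Y a n ω) (fun t S => V t S ω) hnodup hall T
      (m₁, k₁)).trans (Nat.add_le_add_left (countIn_mono _ _ (claimed_le ..)) _)
    have e4 := (ucbPulls_le tie (fun a n => Y a n ω) (fun t S => V t S ω) hnodup hall htie le_rfl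
      hne rfl (t := T)).trans (countIn_mono _ _ (claimed_le ..))
    simp only [Pi.add_apply]
    norm_cast
    omega
  · rw [integral_add' ((integrable_const (1 : ℝ)).add h1) (h2.add h3), integral_add' h2 h3,
      integral_add' (integrable_const (1 : ℝ)) h1, integral_const]
    have b1 := integral_countIn_not_activeAt_le hrand hν hpos T
    have b2 := integral_multiPulls_le hrand hν hnodup hall hdom (tie := tie) T (m₁, k)
    have b3 := integral_countIn_beats_le hrand hν hgap T
    simp only [probReal_univ, smul_eq_mul]
    linarith

omit hdom in
/-- The expected number of pulls of an arm of another category. -/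
lemma integral_pulls_le_of_other_category (hdom : GroupSparse ν m₁)
    (htie : ∀ N S, S.Nonempty → tie N S ∈ S) (hpos : 0 < armMean ν (m₁, k₁)) {m : Fin M}
    (hm : m ≠ m₁) (k : Fin K) (T : ℕ) :
    ∫ ω, ((run order tie (fun a n => Y a n ω) (fun t S => V t S ω) T).pulls (m, k) : ℝ) ∂P ≤
      (3 + 32 / armMean ν (m₁, k₁) ^ 2 * Real.log (16 / armMean ν (m₁, k₁) ^ 2) +
        8 / armMean ν (m₁, k₁) ^ 2) + K * (Real.pi ^ 2 / 6) := by
  have : Nonempty (Arm M K) := ⟨(m₁, k₁)⟩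
  have h1 := (integrable_countIn (P := P) (p := fun ω n =>
    ¬ActiveAt (fun a n => Y a n ω) (m₁, k₁) n) (fun n =>
      (measurableSet_activeAt hrand.measurable_reward (m₁, k₁) n).compl) 1 (T + 1)).1
  have h2 : ∀ j : Fin K, Integrable (fun ω =>
      (countIn (ActiveAt (fun a n => Y a n ω) (m, j)) 2 (T + 1) : ℝ)) P := fun j =>
    (integrable_countIn (fun n => measurableSet_activeAt hrand.measurable_reward (m, j) n) 2
      (T + 1)).1
  have h3 : Integrable (fun ω => ∑ j : Fin K,
      (countIn (ActiveAt (fun a n => Y a n ω) (m, j)) 2 (T + 1) : ℝ)) P :=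
    integrable_finsetSum _ fun j _ => h2 j
  -- Here `K + 2` is `K + 1` plus the initial sweep. With the `1` from the inactivity count and the
  -- saved `K`, the constant `3` remains.
  have h4 := ((integrable_const (K + 2 : ℝ)).add h1).add h3
  refine (integral_mono_ae (integrable_pulls hrand order tie T (m, k)) h4 ?_).trans ?_
  · filter_upwards [ae_draw_mem hrand] with ω hω
    have e1 := claimed_le_of_category tie (fun a n => Y a n ω) (fun t S => V t S ω) hnodup hall
      htie hω T m k
    have e2 := pulls_le_claimed order tie (fun a n => Y a n ω) (fun t S => V t S ω) T (m, k)
    have e3 := (sweeps_le tie (fun a n => Y a n ω) (fun t S => V t S ω) hnodup hall T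
      (m₁, k₁)).trans (Nat.add_le_add_left (countIn_mono _ _ (claimed_le ..)) _)
    have e4 := Finset.sum_le_sum fun j (_ : j ∈ Finset.univ) =>
      countIn_mono (ActiveAt (fun a n => Y a n ω) (m, j)) 2
        (claimed_le order tie (fun a n => Y a n ω) (fun t S => V t S ω) T (m, j))
    simp only [Pi.add_apply]
    norm_cast
    omega
  · rw [integral_add' ((integrable_const (K + 2 : ℝ)).add h1) h3,
      integral_add' (integrable_const (K + 2 : ℝ)) h1, integral_const,
      integral_finsetSum _ fun j _ => h2 j]
    have b1 := integral_countIn_not_activeAt_le hrand hν hpos T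
    have b2 := Finset.sum_le_sum fun (j : Fin K) (_ : j ∈ Finset.univ) =>
      integral_countIn_two_activeAt_le hrand hν (hdom.2 m hm j) T
    simp only [Finset.sum_const, Finset.card_univ, Fintype.card_fin, nsmul_eq_mul] at b2
    simp only [probReal_univ, smul_eq_mul]
    linarith

end Expectation

/-! ### From pull counts to regret. -/

lemma regret_eq_sum (ν : Arm M K → Measure ℝ) (b : Arm M K) (order : List (Arm M K))
    (tie : (Arm M K → ℕ) → Finset (Fin K) → Fin K)
    (y : Arm M K → ℕ → ℝ) (v : ℕ → Finset (Arm M K) → Arm M K) (T : ℕ) :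
    regret ν b order tie y v T = ∑ m, ∑ k, gap ν b (m, k) * (run order tie y v T).pulls (m, k) := by
  rw [← Fintype.sum_prod_type' fun m k => gap ν b (m, k) * ((run order tie y v T).pulls (m, k) : ℝ)]
  simp only [pulls_eq_sum, Nat.cast_sum, Nat.cast_ite, Nat.cast_one, Nat.cast_zero,
    Finset.mul_sum, Prod.mk.eta]
  rw [Finset.sum_comm, regret]
  simp

end CategorizedBandit

end

theorem mainTheorem4 {M K : ℕ}
    (ν : CategorizedBandit.Arm M K → MeasureTheory.Measure ℝ)
    [∀ a, MeasureTheory.IsProbabilityMeasure (ν a)]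
    (hν : ∀ a, ProbabilityTheory.HasSubgaussianMGF
      (fun x : ℝ => x - CategorizedBandit.armMean ν a) 1 (ν a))
    (m₁ : Fin M) (k₁ : Fin K)
    (hdom : CategorizedBandit.GroupSparse ν m₁)
    (hbest : ∀ k, CategorizedBandit.armMean ν (m₁, k) ≤ CategorizedBandit.armMean ν (m₁, k₁))
    (order : List (CategorizedBandit.Arm M K)) (hnodup : order.Nodup) (hall : ∀ a, a ∈ order)
    (tie : (CategorizedBandit.Arm M K → ℕ) → Finset (Fin K) → Fin K)
    (htie : ∀ N S, S.Nonempty → tie N S ∈ S)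
    {Ω : Type*} [MeasurableSpace Ω] (P : MeasureTheory.Measure Ω)
    [MeasureTheory.IsProbabilityMeasure P]
    (Y : CategorizedBandit.Arm M K → ℕ → Ω → ℝ)
    (V : ℕ → Finset (CategorizedBandit.Arm M K) → Ω → CategorizedBandit.Arm M K)
    (hrand : CategorizedBandit.IsRandomness P ν Y V)
    (T : ℕ) :
    let R : Ω → ℝ := fun ω =>
      CategorizedBandit.regret ν (m₁, k₁) order tie (fun a n => Y a n ω) (fun t S => V t S ω) T
    let Δ : Fin M → Fin K → ℝ := fun m k => CategorizedBandit.gap ν (m₁, k₁) (m, k)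
    let μ : ℝ := CategorizedBandit.armMean ν (m₁, k₁)
    MeasureTheory.Integrable R P ∧
    ∫ ω, R ω ∂P ≤
      ∑ k ∈ Finset.univ.filter (fun k => 0 < Δ m₁ k), 16 * Real.log T / Δ m₁ k
        + 3 * ∑ k, Δ m₁ k
        + (3 + 32 / μ ^ 2 * Real.log (16 / μ ^ 2) + 8 / μ ^ 2) * ∑ m, ∑ k, Δ m k
        + ((M : ℝ) - 1) * K * (Real.pi ^ 2 / 6) * ∑ m, ∑ k, Δ m k := by
  intro R Δ μ
  have hpos : 0 < μ := by
    obtain ⟨k, hk⟩ := hdom.1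
    exact hk.trans_le (hbest k)
  have hΔ : ∀ m k, 0 ≤ Δ m k := by
    intro m k
    refine sub_nonneg.2 ?_
    by_cases hm : m = m₁
    · subst hm
      exact hbest k
    · exact (hdom.2 m hm k).trans hpos.le
  have hR : R = fun ω => ∑ m, ∑ k, Δ m k * ((CategorizedBandit.run order tie
      (fun a n => Y a n ω) (fun t S => V t S ω) T).pulls (m, k) : ℝ) :=
    funext fun ω => CategorizedBandit.regret_eq_sum ..
  have hint : ∀ m k, MeasureTheory.Integrable (fun ω => Δ m k * ((CategorizedBandit.run order tie
      (fun a n => Y a n ω) (fun t S => V t S ω) T).pulls (m, k) : ℝ)) P := fun m k =>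
    (CategorizedBandit.integrable_pulls hrand order tie T (m, k)).const_mul _
  have hint' : ∀ m, MeasureTheory.Integrable (fun ω => ∑ k, Δ m k * ((CategorizedBandit.run order
      tie (fun a n => Y a n ω) (fun t S => V t S ω) T).pulls (m, k) : ℝ)) P := fun m =>
    MeasureTheory.integrable_finsetSum _ fun k _ => hint m k
  refine ⟨hR ▸ MeasureTheory.integrable_finsetSum _ fun m _ => hint' m, ?_⟩
  rw [hR, MeasureTheory.integral_finsetSum _ fun m _ => hint' m]
  simp only [MeasureTheory.integral_finsetSum _ fun k _ => hint _ k,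
    MeasureTheory.integral_const_mul]
  set A : ℝ := 3 + 32 / μ ^ 2 * Real.log (16 / μ ^ 2) + 8 / μ ^ 2 with hA
  set B : ℝ := ((M : ℝ) - 1) * K * (Real.pi ^ 2 / 6) with hB
  -- For suboptimal arms of `m₁` the constant `6` splits into the `3` inside `A` and the extra `3 *
  -- Δ m₁ k`. Optimal arms have no useful pull bound, but their gap is zero.
  have hkey : ∀ m k, Δ m k * ∫ ω, ((CategorizedBandit.run order tie
      (fun a n => Y a n ω) (fun t S => V t S ω) T).pulls (m, k) : ℝ) ∂P ≤
      (A * Δ m k + B * Δ m k) + if m = m₁ then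
        ((if 0 < Δ m₁ k then 16 * Real.log T / Δ m₁ k else 0) + 3 * Δ m₁ k) else 0 := by
    intro m k
    by_cases hm : m = m₁
    · subst hm
      rw [if_pos rfl]
      rcases (hΔ m k).eq_or_lt with h0 | h0
      · rw [← h0]
        simp
      · rw [if_pos h0]
        have h := CategorizedBandit.integral_pulls_le_of_same_category hrand hν hnodup hall hdom
          htie hpos h0 T
        refine (mul_le_mul_of_nonneg_left h h0.le).trans_eq ?_
        have h0' : CategorizedBandit.gap ν (m, k₁) (m, k) ≠ 0 := h0.ne'
        simp only [hA, hB, Δ, μ]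
        field_simp
        ring
    · rw [if_neg hm, add_zero, ← add_mul, mul_comm]
      refine mul_le_mul_of_nonneg_right ?_ (hΔ m k)
      refine (CategorizedBandit.integral_pulls_le_of_other_category hrand hν hnodup hall hdom
        htie hpos hm k T).trans (add_le_add le_rfl ?_)
      -- A second category exists, so `K * (π ^ 2 / 6)` is at most `B`.
      have hM : (2 : ℝ) ≤ M := by
        have h1 := m.2
        have h2 := m₁.2
        have h3 : (m : ℕ) ≠ m₁ := fun h => hm (Fin.ext h)
        exact_mod_cast (by omega : 2 ≤ M)
      rw [hB, mul_assoc]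
      exact le_mul_of_one_le_left (by positivity) (by linarith)
  refine (Finset.sum_le_sum fun m _ => Finset.sum_le_sum fun k _ => hkey m k).trans_eq ?_
  simp only [Finset.sum_add_distrib, ← Finset.mul_sum]
  rw [Finset.sum_comm (f := fun m k => if m = m₁ then _ else _)]
  simp only [Finset.sum_ite_eq', Finset.mem_univ, if_true, Finset.sum_add_distrib, Finset.mul_sum,
    Finset.sum_filter]
  ring
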